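/- Let $\mathbb{D}$ be the open unit disk, $\mathbb{T}$ the unit circle, and let $\varphi:\mathbb{D}\to\mathbb{D}$ be holomorphic. Put $$D_\varphi(z)=\frac{(1-|z|^2)\varphi'(z)}{1-|\varphi(z)|^2},\qquad A_\varphi(z)=(1-|z|^2)\frac{\partial}{\partial z}\log|D_\varphi(z)|,$$ the latter where $\varphi'(z)\ne0$, and let $E$ be the set of $z\in\mathbb{D}$ with $\varphi'(z)\neq0$ and $A_\varphi(z)\ne 0$. For $z_0\in E$ the trajectory of $\varphi$ through $z_0$ is the maximal solution $z:(\omega^-,\omega^+)\to E$, $(\omega^-,\omega^+)\subset(0,1)$, of $$z'(t)=\frac{1-|z(t)|^2}{2t\,A_\varphi(z(t))},\qquad z(t_0)=z_0,\qquad t_0=|D_\varphi(z_0)|,$$ and $\Gamma^+=\{z(t):t_0\le t<\omega^+\}$. Let $c=\inf_{\mathbb{D}}|D_\varphi|$, $d=\sup_{\mathbb{D}}|D_\varphi|$, $C_\varphi(t)=\{z\in\mathbb{D}:|D_\varphi(z)|=t\}$ and $B(t)=\{z\in\mathbb{D}:|D_\varphi(z)|\ge t\}$. Theorem 2. Suppose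 that $\varphi$ is locally univalent, that $A_\varphi(z)\ne0$ for all $z\in\mathbb{D}$, and that $\omega^-=c$ and $\omega^+=d$ for every trajectory. Then for every $t\in(c,d)$ the level set $C_\varphi(t)$ is an open Jordan arc (a homeomorphic image of an open interval). Furthermore, $B=\bigcap_{c<t<d}\overline{B(t)}$ is a (non-empty) compact connected subset of $\mathbb{T}$ and every trajectory ends on $B$: the set $\overline{\Gamma^+}\setminus\Gamma^+$ is non-empty and contained in $B$, and the distance from $z(t)$ to $B$ tends to $0$ as $t\to\omega^+$. -/

import Mathlib

open Set Filter Topology Metric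

/-- The open unit disk. -/
def unitDisk : Set ℂ := ball 0 1

/-- `φ` is locally univalent in the unit disk: every point has a neighborhood on which `φ` is
injective. -/
def LocallyUnivalent (φ : ℂ → ℂ) : Prop :=
  ∀ z ∈ unitDisk, ∃ U ∈ 𝓝 z, InjOn φ U

/-- The first order operator `D_φ(z) = (1 - |z|²) φ'(z) / (1 - |φ(z)|²)`. -/
noncomputable def hypD (φ : ℂ → ℂ) (z : ℂ) : ℂ :=
  ((1 - ‖z‖ ^ 2 : ℝ) : ℂ) * deriv φ z / ((1 - ‖φ z‖ ^ 2 : ℝ) : ℂ)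

/-- The Wirtinger derivative `∂u/∂z = (1/2) (∂u/∂x - i ∂u/∂y)` of a real-valued function. -/
noncomputable def wirtingerDz (u : ℂ → ℝ) (z : ℂ) : ℂ :=
  (1 / 2 : ℂ) * ((fderiv ℝ u z 1 : ℂ) - Complex.I * (fderiv ℝ u z Complex.I : ℂ))

/-- The second order operator `A_φ(z) = (1 - |z|²) ∂/∂z log |D_φ(z)|`, meaningful where
`φ'(z) ≠ 0`. -/
noncomputable def hypA (φ : ℂ → ℂ) (z : ℂ) : ℂ :=
  ((1 - ‖z‖ ^ 2 : ℝ) : ℂ) * wirtingerDz (fun w => Real.log ‖hypD φ w‖) z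

/-- The level set `C_φ(t)`. -/
def levelSet (φ : ℂ → ℂ) (t : ℝ) : Set ℂ := {z ∈ unitDisk | ‖hypD φ z‖ = t}

/-- The superlevel set `B(t)`. -/
def superLevelSet (φ : ℂ → ℂ) (t : ℝ) : Set ℂ := {z ∈ unitDisk | t ≤ ‖hypD φ z‖}

/-- `c`, the infimum of `|D_φ|` over the unit disk. -/
noncomputable def levelInf (φ : ℂ → ℂ) : ℝ := sInf ((fun z => ‖hypD φ z‖) '' unitDisk)

/-- `d`, the supremum of `|D_φ|` over the unit disk. -/
noncomputable def levelSup (φ : ℂ → ℂ) : ℝ := sSup ((fun z => ‖hypD φ z‖) '' unitDisk)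

/-- The set `E` of points of the disk at which neither `φ'` nor `A_φ` vanishes. -/
def regularSet (φ : ℂ → ℂ) : Set ℂ := {z ∈ unitDisk | deriv φ z ≠ 0 ∧ hypA φ z ≠ 0}

/-- The time-dependent vector field `G(t, z) = (1 - |z|²) / (2 t A_φ(z))`. -/
noncomputable def trajField (φ : ℂ → ℂ) (t : ℝ) (z : ℂ) : ℂ :=
  ((1 - ‖z‖ ^ 2 : ℝ) : ℂ) / (2 * (t : ℂ) * hypA φ z)

/-- `z` solves, on the open interval `(a, b)`, the initial value problem `z' = G(t, z)`,
`z(t₀) = z₀` in the domain `(0, 1) × E`, where `t₀ = |D_φ(z₀)|` is the level of `z₀`.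
The values of `z` outside `(a, b)` are irrelevant. -/
structure IsTrajSolution (φ : ℂ → ℂ) (z₀ : ℂ) (a b : ℝ) (z : ℝ → ℂ) : Prop where
  interval_subset : Ioo a b ⊆ Ioo 0 1
  level_mem : ‖hypD φ z₀‖ ∈ Ioo a b
  initial : z ‖hypD φ z₀‖ = z₀
  mem_regularSet : ∀ t ∈ Ioo a b, z t ∈ regularSet φ
  hasDerivAt : ∀ t ∈ Ioo a b, HasDerivAt z (trajField φ t (z t)) t

/-- `z`, defined on `(a, b) = (ω⁻, ω⁺)`, is the trajectory of `φ` through `z₀`: a maximal solution,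
that is, one which no solution on a larger open interval extends. -/
structure IsTrajectory (φ : ℂ → ℂ) (z₀ : ℂ) (a b : ℝ) (z : ℝ → ℂ) : Prop
    extends IsTrajSolution φ z₀ a b z where
  maximal : ∀ (a' b' : ℝ) (w : ℝ → ℂ), IsTrajSolution φ z₀ a' b' w → a' ≤ a → b ≤ b' →
    EqOn w z (Ioo a b) → a' = a ∧ b' = b

/-- `Γ⁺ = {z(t) : t₀ ≤ t < ω⁺}`, for a trajectory `z` with right end `b = ω⁺` through `z₀`,
where `t₀ = |D_φ(z₀)|`. -/
def forwardTraj (φ : ℂ → ℂ) (z₀ : ℂ) (b : ℝ) (z : ℝ → ℂ) : Set ℂ := z '' Ico ‖hypD φ z₀‖ b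

/-- An open Jordan arc: a homeomorphic image of an open interval. -/
def IsOpenJordanArc (S : Set ℂ) : Prop :=
  ∃ γ : Ioo (0 : ℝ) 1 → ℂ, IsEmbedding γ ∧ range γ = S

/-- `B`, the intersection of the closures of the sets `B(t)`, `c < t < d`. -/
def endSet (φ : ℂ → ℂ) : Set ℂ :=
  ⋂ t ∈ Ioo (levelInf φ) (levelSup φ), closure (superLevelSet φ t)

/-!
Write `f = |D_φ|`. Local univalence gives `φ' ≠ 0`, so `f` is positive and smooth, and `A_φ ≠ 0`
says that `f` has no critical points; by the Schwarz–Pick lemma and the maximum argument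
`0 < f < 1`. Along a trajectory `f (z t) = t`, so trajectories are the integral curves of the
autonomous field `V = ∇f / |∇f|²` (`levelField`), parametrized by the level. Since every trajectory
runs through all levels in `(c, d)`, following it to the level `s` defines maps `Φ _ s` of the whole
disk onto the level sets (`IsLevelFlow`), continuous by continuous dependence on initial values
(`IsLevelFlow.continuousAt`).

Hence each level set, an image of the disk, is connected, and so is each set `B(t)`, whose points
are joined to the level set of `t` by trajectories. In particular `B`, a decreasing intersection of
compact connected sets, is compact and connected. It misses the open disk because `f` does not
attain `d`, and a trajectory enters every `B(t)`, which gives the claims on its end.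

A level set is not compact: otherwise a thin annulus along the unit circle would lie on one side of
the level, and `f` would attain its minimum or its maximum in the disk
(`IsLevelFlow.not_isCompact_level`). Being connected, the level set is a single integral curve of
the tangent field `iV`, and this curve is injective, since a closed orbit would be compact
(`isOpenJordanArc_level`). An injective curve that locally covers the level set is a homeomorphism
from an open interval onto it.
-/

/-! ### Integral curves of an autonomous vector field in an open set -/

section IntegralCurves

variable {E : Type*} [NormedAddCommGroup E] [NormedSpace ℝ E] {V : E → E} {U : Set E}
  {γ σ : ℝ → E} {J J' : Set ℝ} {t₀ : ℝ}

/-- `γ` is, on the set of times `J`, an integral curve in `U` of the autonomous field `V`, with a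
two-sided derivative at each time of `J`. -/
def IsSolOn (V : E → E) (U : Set E) (γ : ℝ → E) (J : Set ℝ) : Prop :=
  ∀ t ∈ J, γ t ∈ U ∧ HasDerivAt γ (V (γ t)) t

theorem IsSolOn.mono (h : IsSolOn V U γ J) (hJ : J' ⊆ J) : IsSolOn V U γ J' :=
  fun t ht => h t (hJ ht)

theorem IsSolOn.continuousOn (h : IsSolOn V U γ J) : ContinuousOn γ J :=
  fun t ht => (h t ht).2.continuousAt.continuousWithinAt

theorem IsSolOn.comp_sub (h : IsSolOn V U γ J) (a : ℝ) :
    IsSolOn V U (fun t => γ (t - a)) ((fun t => t - a) ⁻¹' J) := fun t ht =>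
  ⟨(h _ ht).1, (h _ ht).2.comp_sub_const t a⟩

theorem IsSolOn.congr (h : IsSolOn V U γ J) (hJ : IsOpen J) (hσ : EqOn σ γ J) :
    IsSolOn V U σ J := fun t ht => by
  rw [hσ ht]
  exact ⟨(h t ht).1, (h t ht).2.congr_of_eventuallyEq (hσ.eventuallyEq_of_mem (hJ.mem_nhds ht))⟩

theorem IsSolOn.eventuallyEq (hV : ∀ z ∈ U, ContDiffAt ℝ 1 V z) (hJ : J ∈ 𝓝 t₀)
    (hγ : IsSolOn V U γ J) (hσ : IsSolOn V U σ J) (h : γ t₀ = σ t₀) : γ =ᶠ[𝓝 t₀] σ := by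
  have ht : t₀ ∈ J := mem_of_mem_nhds hJ
  obtain ⟨K, s, hs, hl⟩ := (hV _ (hγ t₀ ht).1).exists_lipschitzOnWith
  refine ODE_solution_unique_of_eventually (v := fun _ => V) (s := fun _ => s) (K := K)
    (Eventually.of_forall fun _ => hl) ?_ ?_ h
  · filter_upwards [hJ, (hγ t₀ ht).2.continuousAt hs] with t h1 h2 using ⟨(hγ t h1).2, h2⟩
  · rw [h] at hs
    filter_upwards [hJ, (hσ t₀ ht).2.continuousAt hs] with t h1 h2 using ⟨(hσ t h1).2, h2⟩

theorem IsSolOn.eqOn (hV : ∀ z ∈ U, ContDiffAt ℝ 1 V z) (hJo : IsOpen J)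
    (hJ : IsPreconnected J) (hγ : IsSolOn V U γ J) (hσ : IsSolOn V U σ J) (ht : t₀ ∈ J)
    (h : γ t₀ = σ t₀) : EqOn γ σ J := by
  have hsub : J ⊆ {t | γ =ᶠ[𝓝 t] σ} := by
    refine hJ.subset_of_closure_inter_subset isOpen_setOfPred_eventually_nhds
      ⟨t₀, ht, IsSolOn.eventuallyEq hV (hJo.mem_nhds ht) hγ hσ h⟩ ?_
    rintro t ⟨htc, htJ⟩
    refine IsSolOn.eventuallyEq hV (hJo.mem_nhds htJ) hγ hσ ?_
    have hc : ContinuousAt (fun s => (γ s, σ s)) t :=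
      (hγ t htJ).2.continuousAt.prodMk (hσ t htJ).2.continuousAt
    have hfr : ∃ᶠ s in 𝓝 t, (γ s, σ s) ∈ diagonal E := by
      refine (mem_closure_iff_frequently.1 htc).mono fun s hs => ?_
      exact hs.self_of_nhds
    exact isClosed_diagonal.mem_of_frequently_of_tendsto hfr hc
  exact fun t ht => (hsub ht).self_of_nhds

/-- Two integral curves that agree at one common time glue to an integral curve on the union of
their intervals. -/
theorem IsSolOn.union (hV : ∀ z ∈ U, ContDiffAt ℝ 1 V z) (hJo : IsOpen J) (hJo' : IsOpen J')
    (hJ : IsPreconnected J) (hJ' : IsPreconnected J') (hγ : IsSolOn V U γ J)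
    (hσ : IsSolOn V U σ J') (ht : t₀ ∈ J ∩ J') (h : γ t₀ = σ t₀) :
    ∃ ρ : ℝ → E, IsSolOn V U ρ (J ∪ J') ∧ EqOn ρ γ J ∧ EqOn ρ σ J' := by
  classical
  have hcap : EqOn γ σ (J ∩ J') := IsSolOn.eqOn hV (hJo.inter hJo')
    (isPreconnected_iff_ordConnected.2
      ((isPreconnected_iff_ordConnected.1 hJ).inter (isPreconnected_iff_ordConnected.1 hJ')))
    (hγ.mono inter_subset_left) (hσ.mono inter_subset_right) ht h
  have h1 : EqOn (J.piecewise γ σ) γ J := piecewise_eqOn J γ σ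
  have h2 : EqOn (J.piecewise γ σ) σ J' := fun t ht' => by
    by_cases htJ : t ∈ J
    · rw [h1 htJ, hcap ⟨htJ, ht'⟩]
    · exact piecewise_eq_of_notMem J γ σ htJ
  refine ⟨J.piecewise γ σ, ?_, h1, h2⟩
  rintro t (ht | ht)
  · exact hγ.congr hJo h1 t ht
  · exact hσ.congr hJo' h2 t ht

theorem exists_isSolOn_Ioo [CompleteSpace E] (hU : IsOpen U)
    (hV : ∀ z ∈ U, ContDiffAt ℝ 1 V z) {p : E} (hp : p ∈ U) (t₀ : ℝ) :
    ∃ γ : ℝ → E, ∃ ε > 0, γ t₀ = p ∧ IsSolOn V U γ (Ioo (t₀ - ε) (t₀ + ε)) := by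
  obtain ⟨γ, h0, ε, hε, hγ⟩ :=
    (hV p hp).exists_forall_mem_closedBall_exists_eq_forall_mem_Ioo_hasDerivAt₀ t₀
  have hc : ContinuousAt γ t₀ := (hγ t₀ ⟨by linarith, by linarith⟩).continuousAt
  obtain ⟨δ, hδ, hδU⟩ := Metric.mem_nhds_iff.1 (hc (hU.mem_nhds (h0 ▸ hp)))
  rw [Real.ball_eq_Ioo] at hδU
  refine ⟨γ, min δ ε, lt_min hδ hε, h0, fun t ht => ⟨hδU ?_, hγ t ?_⟩⟩
  · exact ⟨by linarith [ht.1, min_le_left δ ε], by linarith [ht.2, min_le_left δ ε]⟩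
  · exact ⟨by linarith [ht.1, min_le_right δ ε], by linarith [ht.2, min_le_right δ ε]⟩

/-- Existence of a maximal integral curve through `p`: it lives on an open interval `J`, and the
interval of any integral curve which meets it at a common time is contained in `J`. -/
theorem exists_maximal_isSolOn [CompleteSpace E] (hU : IsOpen U)
    (hV : ∀ z ∈ U, ContDiffAt ℝ 1 V z) {p : E} (hp : p ∈ U) (t₀ : ℝ) :
    ∃ (γ : ℝ → E) (J : Set ℝ), IsOpen J ∧ IsPreconnected J ∧ t₀ ∈ J ∧ γ t₀ = p ∧
      IsSolOn V U γ J ∧ ∀ (σ : ℝ → E) (J' : Set ℝ), IsOpen J' → IsPreconnected J' →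
        IsSolOn V U σ J' → ∀ t ∈ J ∩ J', γ t = σ t → J' ⊆ J ∧ EqOn γ σ J' := by
  classical
  let S : Set (Set ℝ) := {J | IsOpen J ∧ IsPreconnected J ∧ t₀ ∈ J ∧
    ∃ γ : ℝ → E, γ t₀ = p ∧ IsSolOn V U γ J}
  choose! c hc0 hc using fun (J : Set ℝ) (hJ : J ∈ S) => hJ.2.2.2
  have hex : ∀ t ∈ ⋃₀ S, ∃ J ∈ S, t ∈ J := fun t ht => ht
  choose! K hKS hK using hex
  have hagree : ∀ J ∈ S, EqOn (fun t => c (K t) t) (c J) J := by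
    intro J hJ t ht
    have hKt := hKS t ⟨J, hJ, ht⟩
    refine IsSolOn.eqOn hV (hKt.1.inter hJ.1)
      (isPreconnected_iff_ordConnected.2 ((isPreconnected_iff_ordConnected.1 hKt.2.1).inter
        (isPreconnected_iff_ordConnected.1 hJ.2.1)))
      ((hc _ hKt).mono inter_subset_left) ((hc _ hJ).mono inter_subset_right)
      ⟨hKt.2.2.1, hJ.2.2.1⟩ ?_ ⟨hK t ⟨J, hJ, ht⟩, ht⟩
    rw [hc0 _ hKt, hc0 _ hJ]
  have hopen : IsOpen (⋃₀ S) := isOpen_sUnion fun J hJ => hJ.1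
  have hconn : IsPreconnected (⋃₀ S) :=
    isPreconnected_sUnion t₀ S (fun J hJ => hJ.2.2.1) fun J hJ => hJ.2.1
  obtain ⟨γ₀, ε, hε, h0, hγ₀⟩ := exists_isSolOn_Ioo hU hV hp t₀
  have hS0 : Ioo (t₀ - ε) (t₀ + ε) ∈ S :=
    ⟨isOpen_Ioo, isPreconnected_Ioo, ⟨by linarith, by linarith⟩, γ₀, h0, hγ₀⟩
  have ht₀ : t₀ ∈ ⋃₀ S := ⟨_, hS0, hS0.2.2.1⟩
  have hsol : IsSolOn V U (fun t => c (K t) t) (⋃₀ S) := by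
    rintro t ⟨J, hJ, ht⟩
    exact (hc J hJ).congr hJ.1 (hagree J hJ) t ht
  have hp0 : c (K t₀) t₀ = p := hc0 _ (hKS t₀ ht₀)
  refine ⟨fun t => c (K t) t, ⋃₀ S, hopen, hconn, ht₀, hp0, hsol, ?_⟩
  intro σ J' hJo' hJ' hσ t ht heq
  obtain ⟨ρ, hρ, hρ1, hρ2⟩ := IsSolOn.union hV hopen hJo' hconn hJ' hsol hσ ht heq
  have hmem : (⋃₀ S) ∪ J' ∈ S :=
    ⟨hopen.union hJo', hconn.union t ht.1 ht.2 hJ', Or.inl ht₀, ρ, (hρ1 ht₀).trans hp0, hρ⟩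
  have hsub : J' ⊆ ⋃₀ S := fun s hs => ⟨_, hmem, Or.inr hs⟩
  exact ⟨hsub, fun s hs => by rw [← hρ2 hs, hρ1 (hsub hs)]⟩

end IntegralCurves

/-! ### Flows that raise a function at unit speed -/

section LevelFlow

variable {E : Type*} [NormedAddCommGroup E] [NormedSpace ℝ E] {V : E → E} {U : Set E}
  {f : E → ℝ} {c d : ℝ} {Φ : E → ℝ → E}

/-- If `df(V) = k` on `U`, then `f` grows at the constant rate `k` along integral curves of `V`. -/
theorem IsSolOn.level_sub_level {J : Set ℝ} {γ : ℝ → E} {k : ℝ} (hγ : IsSolOn V U γ J)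
    (hJo : IsOpen J) (hJ : IsPreconnected J) (hf : ∀ z ∈ U, DifferentiableAt ℝ f z)
    (hk : ∀ z ∈ U, fderiv ℝ f z (V z) = k) {s t : ℝ} (hs : s ∈ J) (ht : t ∈ J) :
    f (γ t) - f (γ s) = k * (t - s) := by
  have hd : ∀ r ∈ J, HasDerivAt (fun r => f (γ r) - k * r) 0 r := fun r hr => by
    have h1 := (hf _ (hγ r hr).1).hasFDerivAt.comp_hasDerivAt r (hγ r hr).2
    rw [hk _ (hγ r hr).1] at h1
    simpa [Function.comp_def] using h1.fun_sub ((hasDerivAt_id r).const_mul k)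
  have := hJo.is_const_of_deriv_eq_zero hJ
    (fun r hr => (hd r hr).differentiableAt.differentiableWithinAt)
    (fun r hr => (hd r hr).deriv) hs ht
  linarith

/-- `Φ z s` is the point at level `s` of the integral curve of `V` through `z`, where `V` is a
`C¹` field along which `f` grows at unit speed; all these curves run through all the levels in
`(c, d)`. Time along a curve is thus measured by the value of `f`. -/
structure IsLevelFlow (V : E → E) (f : E → ℝ) (U : Set E) (c d : ℝ) (Φ : E → ℝ → E) : Prop where
  isOpen : IsOpen U
  contDiffAt : ∀ z ∈ U, ContDiffAt ℝ 1 V z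
  differentiableAt : ∀ z ∈ U, DifferentiableAt ℝ f z
  fderiv_apply : ∀ z ∈ U, fderiv ℝ f z (V z) = 1
  isSolOn : ∀ z ∈ U, IsSolOn V U (Φ z) (Ioo c d)
  mem_Ioo : ∀ z ∈ U, f z ∈ Ioo c d
  apply_level : ∀ z ∈ U, Φ z (f z) = z

namespace IsLevelFlow

theorem level_apply (h : IsLevelFlow V f U c d Φ) {z : E} (hz : z ∈ U) {s : ℝ}
    (hs : s ∈ Ioo c d) : f (Φ z s) = s := by
  have := (h.isSolOn z hz).level_sub_level isOpen_Ioo isPreconnected_Ioo h.differentiableAt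
    h.fderiv_apply (h.mem_Ioo z hz) hs
  rw [h.apply_level z hz] at this
  linarith

theorem apply_eq_of_isSolOn (h : IsLevelFlow V f U c d Φ) {z : E} (hz : z ∈ U) {γ : ℝ → E}
    {J : Set ℝ} (hJo : IsOpen J) (hJ : IsPreconnected J) (hγ : IsSolOn V U γ J) {s : ℝ}
    (hsJ : s ∈ J) (hs : s ∈ Ioo c d) (heq : Φ z s = γ s) {t : ℝ} (htJ : t ∈ J)
    (ht : t ∈ Ioo c d) : Φ z t = γ t :=
  IsSolOn.eqOn h.contDiffAt (isOpen_Ioo.inter hJo)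
    (isPreconnected_iff_ordConnected.2
      (ordConnected_Ioo.inter (isPreconnected_iff_ordConnected.1 hJ)))
    ((h.isSolOn z hz).mono inter_subset_left) (hγ.mono inter_subset_right) ⟨hs, hsJ⟩ heq ⟨ht, htJ⟩

theorem apply_apply (h : IsLevelFlow V f U c d Φ) {z : E} (hz : z ∈ U) {s t : ℝ}
    (hs : s ∈ Ioo c d) (ht : t ∈ Ioo c d) : Φ (Φ z s) t = Φ z t := by
  have hw : Φ z s ∈ U := (h.isSolOn z hz s hs).1
  refine h.apply_eq_of_isSolOn hw isOpen_Ioo isPreconnected_Ioo (h.isSolOn z hz) hs hs ?_ ht ht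
  simpa only [h.level_apply hz hs] using h.apply_level _ hw

/-- Local form of continuity: near a point and its level, the level flow is given by the local flow
of the Picard–Lindelöf theorem. -/
theorem eventually_continuousAt [CompleteSpace E] (h : IsLevelFlow V f U c d Φ) {p : E}
    (hp : p ∈ U) : ∀ᶠ x : E × ℝ in 𝓝 (p, f p), ContinuousAt (fun z => Φ z x.2) x.1 := by
  obtain ⟨ε, hε, a, r, L, K, hr, hpl⟩ := IsPicardLindelof.of_contDiffAt_one (h.contDiffAt p hp)
  obtain ⟨α, hα, hαc⟩ := (hpl 0).exists_forall_mem_closedBall_eq_hasDerivWithinAt_continuousOn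
  simp only [zero_sub, zero_add] at hα hαc
  have hαat : ∀ x : E × ℝ, x.1 ∈ ball p r → x.2 ∈ Ioo (-ε) ε → ContinuousAt α x := fun x h1 h2 =>
    hαc.continuousAt (prod_mem_nhds
      (mem_of_superset (isOpen_ball.mem_nhds h1) ball_subset_closedBall) (Icc_mem_nhds h2.1 h2.2))
  have hr' : (0 : ℝ) < r := hr
  have hα0 : α (p, 0) = p := (hα p (mem_closedBall_self hr'.le)).1
  have hU : ∀ᶠ x : E × ℝ in 𝓝 (p, 0), α x ∈ U :=
    (hαat (p, 0) (mem_ball_self hr') ⟨by linarith, hε⟩) (h.isOpen.mem_nhds (by rwa [hα0]))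
  obtain ⟨δ, hδ, hδU⟩ := Metric.mem_nhds_iff.1 hU
  set η := min δ (min (r : ℝ) ε) with hη
  have hη0 : 0 < η := lt_min hδ (lt_min hr' hε)
  have hηδ : η ≤ δ := min_le_left _ _
  have hηr : η ≤ r := (min_le_right _ _).trans (min_le_left _ _)
  have hηε : η ≤ ε := (min_le_right _ _).trans (min_le_right _ _)
  have hsol : ∀ q ∈ ball p η, IsSolOn V U (fun t => α (q, t)) (Ioo (-η) η) := by
    intro q hq t ht
    refine ⟨hδU ?_, ?_⟩
    · rw [mem_ball, Prod.dist_eq, max_lt_iff]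
      refine ⟨(mem_ball.1 hq).trans_le hηδ, ?_⟩
      simpa [Real.dist_eq] using (abs_lt.2 ht).trans_le hηδ
    · have ht' : t ∈ Ioo (-ε) ε := ⟨by linarith [ht.1], by linarith [ht.2]⟩
      exact ((hα q (ball_subset_closedBall (ball_subset_ball hηr hq))).2 t
        (Ioo_subset_Icc_self ht')).hasDerivAt (Icc_mem_nhds ht'.1 ht'.2)
  -- Near `(p, f p)` the level flow is the local flow `α`, run for the time `s - f q`.
  have hf : ∀ q ∈ U, ContinuousAt f q := fun q hq => (h.differentiableAt q hq).continuousAt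
  have hev : ∀ᶠ x : E × ℝ in 𝓝 (p, f p), x.1 ∈ U ∧ x.1 ∈ ball p η ∧ x.2 ∈ Ioo c d ∧
      x.2 - f x.1 ∈ Ioo (-η) η := by
    have hfst : Tendsto (Prod.fst : E × ℝ → E) (𝓝 (p, f p)) (𝓝 p) := continuousAt_fst
    have hsnd : Tendsto (Prod.snd : E × ℝ → ℝ) (𝓝 (p, f p)) (𝓝 (f p)) := continuousAt_snd
    have hsub : Tendsto (fun x : E × ℝ => x.2 - f x.1) (𝓝 (p, f p)) (𝓝 0) := by
      simpa using hsnd.sub ((hf p hp).tendsto.comp hfst)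
    filter_upwards [hfst (h.isOpen.mem_nhds hp), hfst (ball_mem_nhds p hη0),
      hsnd (isOpen_Ioo.mem_nhds (h.mem_Ioo p hp)), hsub (Ioo_mem_nhds (neg_lt_zero.2 hη0) hη0)]
      with x h1 h2 h3 h4 using ⟨h1, h2, h3, h4⟩
  filter_upwards [hev.eventually_nhds] with x hx
  have hx0 := hx.self_of_nhds
  have hcont : ContinuousAt (fun z => α (z, x.2 - f z)) x.1 := by
    refine ContinuousAt.comp (f := fun z => (z, x.2 - f z)) (hαat (x.1, x.2 - f x.1) ?_ ?_) ?_
    · exact ball_subset_ball hηr hx0.2.1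
    · exact ⟨by linarith [hx0.2.2.2.1], by linarith [hx0.2.2.2.2]⟩
    · exact continuousAt_id.prodMk (continuousAt_const.sub (hf _ hx0.1))
  refine hcont.congr ?_
  have hmk : Tendsto (fun z : E => (z, x.2)) (𝓝 x.1) (𝓝 x) :=
    (Continuous.prodMk_left x.2).continuousAt
  filter_upwards [hmk.eventually hx] with q hq
  have h0 : α (q, 0) = q := (hα q (ball_subset_closedBall (ball_subset_ball hηr hq.2.1))).1
  refine (h.apply_eq_of_isSolOn hq.1 (J := (fun t => t - f q) ⁻¹' Ioo (-η) η)
    (isOpen_Ioo.preimage (by fun_prop)) ?_ ((hsol q hq.2.1).comp_sub (f q)) (s := f q) ?_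
    (h.mem_Ioo q hq.1) ?_ hq.2.2.2 hq.2.2.1).symm
  · rw [preimage_sub_const_Ioo]
    exact isPreconnected_Ioo
  · simp [hη0]
  · simp [h0, h.apply_level q hq.1]

/-- The flow to the level `t` is continuous on `U`. Continuity at the points of one integral curve
propagates along the curve by composition, starting from the local statement. -/
theorem continuousAt [CompleteSpace E] (h : IsLevelFlow V f U c d Φ) {z : E} (hz : z ∈ U) {t : ℝ}
    (ht : t ∈ Ioo c d) : ContinuousAt (fun w => Φ w t) z := by
  have hmem : ∀ s ∈ Ioo c d, Φ z s ∈ U := fun s hs => (h.isSolOn z hz s hs).1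
  have key : ContinuousAt (fun w => Φ w t) (Φ z (f z)) := by
    refine isPreconnected_Ioo.induction₂' (fun s s' => ContinuousAt (fun w => Φ w s') (Φ z s))
      ?_ ?_ (h.mem_Ioo z hz) ht
    · intro s hs
      have hev := h.eventually_continuousAt (hmem s hs)
      rw [h.level_apply hz hs] at hev
      have h1 : Tendsto (fun y : ℝ => (Φ z s, y)) (𝓝[Ioo c d] s) (𝓝 (Φ z s, s)) :=
        (Continuous.prodMk_right (Φ z s)).continuousAt.mono_left nhdsWithin_le_nhds
      have h2 : Tendsto (fun y : ℝ => (Φ z y, s)) (𝓝[Ioo c d] s) (𝓝 (Φ z s, s)) :=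
        ((h.isSolOn z hz s hs).2.continuousAt.prodMk continuousAt_const).mono_left
          nhdsWithin_le_nhds
      exact (h1.eventually hev).and (h2.eventually hev)
    · intro x y w hx hy hw hxy hyw
      have hcomp : ContinuousAt (fun q => Φ (Φ q y) w) (Φ z x) := by
        refine ContinuousAt.comp (f := fun q => Φ q y) (g := fun q => Φ q w) ?_ hxy
        simpa only [h.apply_apply hz hx hy] using hyw
      refine hcomp.congr ?_
      filter_upwards [h.isOpen.mem_nhds (hmem x hx)] with q hq using h.apply_apply hq hy hw
  rwa [h.apply_level z hz] at key

theorem isPreconnected_level [CompleteSpace E] (h : IsLevelFlow V f U c d Φ)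
    (hU : IsPreconnected U) {t : ℝ} (ht : t ∈ Ioo c d) : IsPreconnected {z ∈ U | f z = t} := by
  have : {z ∈ U | f z = t} = (fun z => Φ z t) '' U := by
    ext z
    constructor
    · rintro ⟨hz, rfl⟩
      exact ⟨z, hz, h.apply_level z hz⟩
    · rintro ⟨w, hw, rfl⟩
      exact ⟨(h.isSolOn w hw t ht).1, h.level_apply hw ht⟩
  rw [this]
  exact hU.image _ fun z hz => (h.continuousAt hz ht).continuousWithinAt

/-- A point above level `t` is joined to the level set of `t` by the integral curve through it. -/
theorem isPreconnected_superlevel [CompleteSpace E] (h : IsLevelFlow V f U c d Φ)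
    (hU : IsPreconnected U) {t : ℝ} (ht : t ∈ Ioo c d) : IsPreconnected {z ∈ U | t ≤ f z} := by
  rcases U.eq_empty_or_nonempty with rfl | ⟨z₀, hz₀⟩
  · simpa using isPreconnected_empty
  refine isPreconnected_of_forall (Φ z₀ t) fun z hz => ?_
  have hz' := h.mem_Ioo z hz.1
  have hsub : Icc t (f z) ⊆ Ioo c d := Icc_subset_Ioo ht.1 hz'.2
  refine ⟨{z ∈ U | f z = t} ∪ Φ z '' Icc t (f z), ?_, ?_, ?_, ?_⟩
  · rintro w (hw | ⟨s, hs, rfl⟩)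
    · exact ⟨hw.1, hw.2.ge⟩
    · exact ⟨(h.isSolOn z hz.1 s (hsub hs)).1, by rw [h.level_apply hz.1 (hsub hs)]; exact hs.1⟩
  · exact Or.inl ⟨(h.isSolOn z₀ hz₀ t ht).1, h.level_apply hz₀ ht⟩
  · exact Or.inr ⟨f z, ⟨hz.2, le_rfl⟩, h.apply_level z hz.1⟩
  · exact (h.isPreconnected_level hU ht).union (Φ z t)
      ⟨(h.isSolOn z hz.1 t ht).1, h.level_apply hz.1 ht⟩ ⟨t, ⟨le_rfl, hz.2⟩, rfl⟩
      (isPreconnected_Icc.image _ ((h.isSolOn z hz.1).continuousOn.mono hsub))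

end IsLevelFlow

end LevelFlow

/-! ### Non-compactness of level sets in the disk -/

theorem isPreconnected_annulus (r R : ℝ) : IsPreconnected {z : ℂ | r < ‖z‖ ∧ ‖z‖ < R} := by
  have : {z : ℂ | r < ‖z‖ ∧ ‖z‖ < R} =
      (fun x : ℝ × ℝ => (x.1 : ℂ) * Complex.exp (x.2 * Complex.I)) ''
        ((Ioo r R ∩ Ici 0) ×ˢ univ) := by
    ext z
    constructor
    · rintro ⟨h1, h2⟩
      exact ⟨(‖z‖, z.arg), ⟨⟨⟨h1, h2⟩, norm_nonneg z⟩, trivial⟩, Complex.norm_mul_exp_arg_mul_I z⟩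
    · rintro ⟨x, ⟨⟨hx, hx0⟩, -⟩, rfl⟩
      have : ‖(x.1 : ℂ) * Complex.exp (x.2 * Complex.I)‖ = x.1 := by
        simpa [Complex.norm_exp_ofReal_mul_I] using hx0
      exact ⟨by rw [this]; exact hx.1, by rw [this]; exact hx.2⟩
  rw [this]
  refine IsPreconnected.image ?_ _ (by fun_prop)
  exact (isPreconnected_iff_ordConnected.2 (ordConnected_Ioo.inter ordConnected_Ici)).prod
    isPreconnected_univ

/-- A compact level set would be surrounded by an annulus which lies on one side of the level, so
that `f` would attain its minimum or its maximum in the disk; but the flow leaves no room for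
extrema. -/
theorem IsLevelFlow.not_isCompact_level {V : ℂ → ℂ} {f : ℂ → ℝ} {c d : ℝ} {Φ : ℂ → ℝ → ℂ}
    (h : IsLevelFlow V f (ball 0 1) c d Φ) {t : ℝ} (ht : t ∈ Ioo c d) :
    ¬ IsCompact {z ∈ ball (0 : ℂ) 1 | f z = t} := by
  intro hK
  have h0 : (0 : ℂ) ∈ ball (0 : ℂ) 1 := mem_ball_self one_pos
  set p := Φ 0 t with hp
  have hpU : p ∈ ball (0 : ℂ) 1 := (h.isSolOn 0 h0 t ht).1
  have hpt : f p = t := h.level_apply h0 ht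
  have hfc : ContinuousOn f (ball 0 1) :=
    fun z hz => (h.differentiableAt z hz).continuousAt.continuousWithinAt
  obtain ⟨m, hm, hmax⟩ := hK.exists_isMaxOn ⟨p, hpU, hpt⟩ continuous_norm.continuousOn
  have hm1 : ‖m‖ < 1 := by simpa using hm.1
  have hpm : ‖p‖ ≤ ‖m‖ := hmax ⟨hpU, hpt⟩
  have hball : closedBall (0 : ℂ) ‖m‖ ⊆ ball 0 1 := closedBall_subset_ball hm1
  have hcb : IsCompact (closedBall (0 : ℂ) ‖m‖) := isCompact_closedBall _ _
  have hpcb : p ∈ closedBall (0 : ℂ) ‖m‖ := by simpa using hpm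
  have hann : {z : ℂ | ‖m‖ < ‖z‖ ∧ ‖z‖ < 1} ⊆ ball 0 1 := fun z hz => by simpa using hz.2
  have hne : ∀ z, ‖m‖ < ‖z‖ → ‖z‖ < 1 → f z ≠ t := fun z h1 h2 hz =>
    (h1.not_ge (hmax ⟨by simpa using h2, hz⟩))
  have himg := (isPreconnected_annulus ‖m‖ 1).image f (hfc.mono hann)
  have hside : (∀ z, ‖m‖ < ‖z‖ → ‖z‖ < 1 → t < f z) ∨ (∀ z, ‖m‖ < ‖z‖ → ‖z‖ < 1 → f z < t) := by
    by_contra! hcon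
    obtain ⟨⟨z, hz1, hz2, hz⟩, w, hw1, hw2, hw⟩ := hcon
    obtain ⟨y, hy, hyt⟩ := (isPreconnected_iff_ordConnected.1 himg).out
      ⟨z, ⟨hz1, hz2⟩, rfl⟩ ⟨w, ⟨hw1, hw2⟩, rfl⟩ ⟨hz, hw⟩
    exact hne y hy.1 hy.2 hyt
  rcases hside with hside | hside
  · obtain ⟨q, hq, hmin⟩ := hcb.exists_isMinOn ⟨p, hpcb⟩ (hfc.mono hball)
    have hqU := hball hq
    obtain ⟨s, hs1, hs2⟩ := exists_between (h.mem_Ioo q hqU).1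
    have hsI : s ∈ Ioo c d := ⟨hs1, hs2.trans (h.mem_Ioo q hqU).2⟩
    have hwU := (h.isSolOn q hqU s hsI).1
    have hws := h.level_apply hqU hsI
    have hqp : f q ≤ t := hpt ▸ hmin hpcb
    rcases le_or_gt ‖Φ q s‖ ‖m‖ with hle | hgt
    · have : f q ≤ f (Φ q s) := hmin (by simpa using hle)
      linarith
    · have := hside _ hgt (by simpa using hwU)
      linarith
  · obtain ⟨q, hq, hmx⟩ := hcb.exists_isMaxOn ⟨p, hpcb⟩ (hfc.mono hball)
    have hqU := hball hq
    obtain ⟨s, hs1, hs2⟩ := exists_between (h.mem_Ioo q hqU).2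
    have hsI : s ∈ Ioo c d := ⟨(h.mem_Ioo q hqU).1.trans hs1, hs2⟩
    have hwU := (h.isSolOn q hqU s hsI).1
    have hws := h.level_apply hqU hsI
    have hqp : t ≤ f q := hpt ▸ hmx hpcb
    rcases le_or_gt ‖Φ q s‖ ‖m‖ with hle | hgt
    · have : f (Φ q s) ≤ f q := hmx (by simpa using hle)
      linarith
    · have := hside _ hgt (by simpa using hwU)
      linarith

/-! ### Level sets as orbits -/

/-- Suppose that `V` is a field with `df(V) = 1`, `df(iV) = 0`. Near a point of an integral curve
of `iV`, the level set of `f` is covered by the curve. Indeed `z ↦ f z + i Im (z / V q)` has the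
invertible derivative `v ↦ v / V q` at `q`, so it is injective near `q`, and along the curve its
imaginary part has derivative one at `q`. -/
theorem eventually_level_mem_image {f : ℂ → ℝ} {V : ℂ → ℂ} {U : Set ℂ}
    (hf : ∀ z ∈ U, ContDiffAt ℝ 1 f z) (hV : ∀ z ∈ U, ContinuousAt V z)
    (hfV : ∀ z ∈ U, fderiv ℝ f z (V z) = 1) (hfI : ∀ z ∈ U, fderiv ℝ f z (Complex.I * V z) = 0)
    {σ : ℝ → ℂ} {J J' : Set ℝ} {t₀ : ℝ} (hσ : IsSolOn (fun z => Complex.I * V z) U σ J)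
    (hJ : J ∈ 𝓝 t₀) (hJ' : J' ∈ 𝓝 t₀) :
    ∀ᶠ z in 𝓝 (σ t₀), f z = f (σ t₀) → z ∈ σ '' J' := by
  set q := σ t₀ with hq
  have hqU : q ∈ U := (hσ t₀ (mem_of_mem_nhds hJ)).1
  have hVq : V q ≠ 0 := fun h0 => by simpa [h0] using hfV q hqU
  have hre : ∀ v : ℂ, fderiv ℝ f q v = (v / V q).re := fun v => by
    have hv : v = (v / V q).re • V q + (v / V q).im • (Complex.I * V q) := by
      have h1 : v = v / V q * V q := by field_simp
      have h2 := Complex.re_add_im (v / V q)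
      conv_lhs => rw [h1, ← h2]
      simp only [Complex.real_smul]
      ring
    conv_lhs => rw [hv, map_add, map_smul, map_smul, hfV q hqU, hfI q hqU]
    simp
  -- The chart `G` and its derivative, multiplication by `(V q)⁻¹`.
  set ℓ : ℂ →L[ℝ] ℝ := Complex.imCLM ∘L (ContinuousLinearMap.mul ℝ ℂ (V q)⁻¹) with hℓ
  have hℓv : ∀ v, ℓ v = (v / V q).im := fun v => by
    simp [hℓ, div_eq_inv_mul]
  set G : ℂ → ℂ := fun z => (f z : ℂ) + (ℓ z : ℂ) * Complex.I with hG
  set e : ℂ ≃L[ℝ] ℂ :=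
    (ContinuousLinearEquiv.unitsEquivAut ℂ (Units.mk0 (V q)⁻¹ (inv_ne_zero hVq))).restrictScalars ℝ
    with he
  have hGd : HasStrictFDerivAt G (e : ℂ →L[ℝ] ℂ) q := by
    have h1 : HasStrictFDerivAt f (fderiv ℝ f q) q := (hf q hqU).hasStrictFDerivAt one_ne_zero
    have h2 := (Complex.ofRealCLM.hasStrictFDerivAt.comp q h1).add
      ((Complex.ofRealCLM.hasStrictFDerivAt.comp q ℓ.hasStrictFDerivAt).mul_const Complex.I)
    refine h2.congr_fderiv ?_
    ext v
    have : e v = v / V q := by simp [he, div_eq_mul_inv]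
    simpa [this, hre, hℓv, mul_comm] using Complex.re_add_im (v / V q)
  obtain ⟨N, hN, hinj⟩ : ∃ N ∈ 𝓝 q, InjOn G N :=
    ⟨_, hGd.toOpenPartialHomeomorph.open_source.mem_nhds hGd.mem_toOpenPartialHomeomorph_source,
      hGd.toOpenPartialHomeomorph.injOn⟩
  have hσc : ContinuousAt σ t₀ := (hσ t₀ (mem_of_mem_nhds hJ)).2.continuousAt
  -- The imaginary part of `G` covers a neighborhood along the curve.
  have hy : HasStrictDerivAt (fun s => ℓ (σ s)) 1 t₀ := by
    have hd : ∀ᶠ s in 𝓝 t₀, HasDerivAt (fun s => ℓ (σ s)) (ℓ (Complex.I * V (σ s))) s := by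
      filter_upwards [hJ] with s hs using ℓ.hasFDerivAt.comp_hasDerivAt s (hσ s hs).2
    have := hasStrictDerivAt_of_hasDerivAt_of_continuousAt hd
      (ℓ.continuous.continuousAt.comp (continuousAt_const.mul ((hV q hqU).comp hσc)))
    have h1 : ℓ (Complex.I * V q) = 1 := by rw [hℓv, mul_div_cancel_right₀ _ hVq, Complex.I_im]
    simpa only [← hq, h1] using this
  obtain ⟨δ, hδ, hball⟩ := Metric.mem_nhds_iff.1 (inter_mem (inter_mem hJ hJ') (hσc hN))
  have himg : (fun s => ℓ (σ s)) '' ball t₀ δ ∈ 𝓝 (ℓ q) := by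
    have := hy.map_nhds_eq one_ne_zero
    rw [hq, ← this]
    exact image_mem_map (ball_mem_nhds t₀ hδ)
  filter_upwards [hN, ℓ.continuous.continuousAt himg] with z hzN hz hfz
  obtain ⟨s, hs, hsz⟩ := hz
  have hconst : f (σ s) = f q := by
    have := (hσ.mono fun r hr => (hball hr).1.1).level_sub_level isOpen_ball
      (convex_ball t₀ δ).isPreconnected (fun w hw => (hf w hw).differentiableAt one_ne_zero) hfI
      (mem_ball_self hδ) hs
    linarith
  refine ⟨s, (hball hs).1.2, hinj (hball hs).2 hzN ?_⟩
  simp only [hG]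
  rw [hconst, hfz]
  simp only at hsz
  rw [hsz]

/-- A preconnected set is contained in any set which, near each point of it, contains either all
or nothing of it. -/
theorem IsPreconnected.subset_of_eventually {X : Type*} [TopologicalSpace X] {L A : Set X}
    (hL : IsPreconnected L) (hne : (L ∩ A).Nonempty)
    (hin : ∀ z ∈ L ∩ A, ∀ᶠ w in 𝓝 z, w ∈ L → w ∈ A)
    (hout : ∀ z ∈ L \ A, ∀ᶠ w in 𝓝 z, w ∈ L → w ∉ A) : L ⊆ A := by
  intro q hq
  by_contra hqA
  obtain ⟨x, hx⟩ := hne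
  obtain ⟨y, hyL, hyu, hyv⟩ := hL {z | ∀ᶠ w in 𝓝 z, w ∈ L → w ∈ A}
    {z | ∀ᶠ w in 𝓝 z, w ∈ L → w ∉ A} isOpen_setOfPred_eventually_nhds
    isOpen_setOfPred_eventually_nhds
    (fun z hz => by
      by_cases hzA : z ∈ A
      · exact Or.inl (hin z ⟨hz, hzA⟩)
      · exact Or.inr (hout z ⟨hz, hzA⟩))
    ⟨x, hx.1, hin x hx⟩ ⟨q, hq, hout q ⟨hq, hqA⟩⟩
  exact hyv.self_of_nhds hyL (hyu.self_of_nhds hyL)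

theorem IsOpen.eq_Ioo_csInf_csSup {J : Set ℝ} (hJo : IsOpen J) (hJ : IsConnected J)
    (hb : BddBelow J) (ha : BddAbove J) : J = Ioo (sInf J) (sSup J) := by
  refine Subset.antisymm (fun x hx => ⟨?_, ?_⟩) (hJ.Ioo_csInf_csSup_subset hb ha)
  · obtain ⟨l, u, hxlu, hlu⟩ := mem_nhds_iff_exists_Ioo_subset.1 (hJo.mem_nhds hx)
    obtain ⟨y, hly, hyx⟩ := exists_between hxlu.1
    exact (csInf_le hb (hlu ⟨hly, hyx.trans hxlu.2⟩)).trans_lt hyx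
  · obtain ⟨l, u, hxlu, hlu⟩ := mem_nhds_iff_exists_Ioo_subset.1 (hJo.mem_nhds hx)
    obtain ⟨y, hxy, hyu⟩ := exists_between hxlu.2
    exact hxy.trans_le (le_csSup ha (hlu ⟨hxlu.1.trans hxy, hyu⟩))

/-- A nonempty open interval of the line, bounded or not, is homeomorphic to `(0, 1)`. -/
theorem exists_isEmbedding_range_eq {J : Set ℝ} (hJo : IsOpen J) (hJ : IsPreconnected J)
    (hne : J.Nonempty) : ∃ h : Ioo (0 : ℝ) 1 → ℝ, IsEmbedding h ∧ range h = J := by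
  let e : ℝ ≃ₜ Ioo (-1 : ℝ) 1 := (orderIsoIooNegOneOne ℝ).toHomeomorph
  let e' : ℝ → ℝ := fun x => e x
  have he' : IsOpenEmbedding e' := isOpen_Ioo.isOpenEmbedding_subtypeVal.comp e.isOpenEmbedding
  have hrange : ∀ x, e' x ∈ Ioo (-1 : ℝ) 1 := fun x => (e x).2
  set I := e' '' J with hI
  have hIo : IsOpen I := he'.isOpenMap J hJo
  have hIc : IsPreconnected I := hJ.image e' he'.continuous.continuousOn
  have hIne : I.Nonempty := hne.image e'
  have hIb : BddBelow I := ⟨-1, by rintro _ ⟨x, -, rfl⟩; exact (hrange x).1.le⟩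
  have hIa : BddAbove I := ⟨1, by rintro _ ⟨x, -, rfl⟩; exact (hrange x).2.le⟩
  set a := sInf I
  set b := sSup I
  have hIoo : I = Ioo a b := hIo.eq_Ioo_csInf_csSup ⟨hIne, hIc⟩ hIb hIa
  have hab : a < b := nonempty_Ioo.1 (hIoo ▸ hIne)
  have hsub : 0 < b - a := sub_pos.2 hab
  let A : ℝ ≃ₜ ℝ := affineHomeomorph (b - a) a hsub.ne'
  have hA : ∀ x, A x = (b - a) * x + a := fun x => rfl
  have hAI : ∀ x : Ioo (0 : ℝ) 1, A x ∈ I := fun x => by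
    rw [hIoo, hA]
    have h0 := x.2.1
    have h1 := x.2.2
    constructor <;> nlinarith
  have hI1 : I ⊆ Ioo (-1 : ℝ) 1 := by rintro _ ⟨x, -, rfl⟩; exact hrange x
  refine ⟨fun x => e.symm ⟨A x, hI1 (hAI x)⟩, ?_, ?_⟩
  · exact e.symm.isEmbedding.comp ((A.isEmbedding.comp .subtypeVal).codRestrict _ _)
  · ext y
    constructor
    · rintro ⟨x, rfl⟩
      obtain ⟨z, hz, hzx⟩ := hAI x
      have : e z = ⟨A x, hI1 (hAI x)⟩ := Subtype.ext hzx
      simp only [← this, Homeomorph.symm_apply_apply]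
      exact hz
    · intro hy
      have hyI : e' y ∈ Ioo a b := hIoo ▸ mem_image_of_mem e' hy
      refine ⟨⟨(e' y - a) / (b - a), ?_, ?_⟩, ?_⟩
      · exact div_pos (sub_pos.2 hyI.1) hsub
      · rw [div_lt_one hsub]; linarith [hyI.2]
      · rw [Homeomorph.symm_apply_eq]
        refine Subtype.ext (show (b - a) * ((e' y - a) / (b - a)) + a = e' y from ?_)
        rw [mul_div_cancel₀ _ hsub.ne', sub_add_cancel]

/-- A connected, non-compact level set of a function `f` without critical points is a single orbit
of the field `iV` tangent to it. A time at which the orbit returned to its start would make the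
level set the image of a compact interval, so the orbit is injective. -/
theorem isOpenJordanArc_level {f : ℂ → ℝ} {V : ℂ → ℂ} {U : Set ℂ} (hU : IsOpen U)
    (hf : ∀ z ∈ U, ContDiffAt ℝ 1 f z) (hV : ∀ z ∈ U, ContDiffAt ℝ 1 V z)
    (hfV : ∀ z ∈ U, fderiv ℝ f z (V z) = 1) (hfI : ∀ z ∈ U, fderiv ℝ f z (Complex.I * V z) = 0)
    {t : ℝ} (hne : {z ∈ U | f z = t}.Nonempty) (hconn : IsPreconnected {z ∈ U | f z = t})
    (hcomp : ¬ IsCompact {z ∈ U | f z = t}) : IsOpenJordanArc {z ∈ U | f z = t} := by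
  set L := {z ∈ U | f z = t} with hL
  obtain ⟨p, hpU, hpt⟩ := hne
  have hVc : ∀ z ∈ U, ContinuousAt V z := fun z hz => (hV z hz).continuousAt
  have hW : ∀ z ∈ U, ContDiffAt ℝ 1 (fun z => Complex.I * V z) z :=
    fun z hz => contDiffAt_const.mul (hV z hz)
  have hfd : ∀ z ∈ U, DifferentiableAt ℝ f z := fun z hz => (hf z hz).differentiableAt one_ne_zero
  obtain ⟨γ, J, hJo, hJ, h0, hγ0, hγ, hmax⟩ := exists_maximal_isSolOn hU hW hpU 0
  have hγL : ∀ s ∈ J, γ s ∈ L := fun s hs => by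
    have := hγ.level_sub_level hJo hJ hfd hfI h0 hs
    rw [hγ0, hpt] at this
    exact ⟨(hγ s hs).1, by linarith⟩
  have hcover : ∀ s ∈ J, ∀ J' ∈ 𝓝 s, ∀ᶠ w in 𝓝 (γ s), w ∈ L → w ∈ γ '' J' := by
    intro s hs J' hJ'
    filter_upwards [eventually_level_mem_image hf hVc hfV hfI hγ (hJo.mem_nhds hs) hJ']
      with w hw hwL using hw (hwL.2.trans (hγL s hs).2.symm)
  have hsurj : L ⊆ γ '' J := by
    refine hconn.subset_of_eventually ⟨p, ⟨hpU, hpt⟩, 0, h0, hγ0⟩ ?_ ?_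
    · rintro _ ⟨-, s, hs, rfl⟩
      exact hcover s hs J (hJo.mem_nhds hs)
    · rintro q ⟨hqL, hqJ⟩
      obtain ⟨σ, ε, hε, hσ0, hσ⟩ := exists_isSolOn_Ioo hU hW hqL.1 0
      have hI : Ioo (0 - ε) (0 + ε) ∈ 𝓝 (0 : ℝ) := Ioo_mem_nhds (by linarith) (by linarith)
      have hev := eventually_level_mem_image hf hVc hfV hfI hσ hI hI
      rw [hσ0] at hev
      filter_upwards [hev] with w hw hwL
      obtain ⟨τ, hτ, rfl⟩ := hw (hwL.2.trans hqL.2.symm)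
      rintro ⟨s, hs, hsτ⟩
      -- The curve through `q`, shifted in time, would extend `γ` and reach `q`.
      have hm := hmax (fun r => σ (r - (s - τ))) ((fun r => r - (s - τ)) ⁻¹' Ioo (0 - ε) (0 + ε))
        (isOpen_Ioo.preimage (by fun_prop))
        (by rw [preimage_sub_const_Ioo]; exact isPreconnected_Ioo)
        (hσ.comp_sub _) s ⟨hs, by simpa only [mem_preimage, sub_sub_cancel] using hτ⟩
        (by simpa using hsτ)
      have hmem : s - τ ∈ (fun r => r - (s - τ)) ⁻¹' Ioo (0 - ε) (0 + ε) := by simpa using hε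
      exact hqJ ⟨s - τ, hm.1 hmem, by simpa [hσ0] using hm.2 hmem⟩
  have hnolt : ∀ s₁ ∈ J, ∀ s₂ ∈ J, s₁ < s₂ → γ s₁ ≠ γ s₂ := by
    intro s₁ h1 s₂ h2 hlt heq
    have hIccJ : Icc s₁ s₂ ⊆ J := (isPreconnected_iff_ordConnected.1 hJ).out h1 h2
    have hAc : IsCompact (γ '' Icc s₁ s₂) :=
      isCompact_Icc.image_of_continuousOn (hγ.continuousOn.mono hIccJ)
    have hAL : γ '' Icc s₁ s₂ ⊆ L := by
      rintro _ ⟨s, hs, rfl⟩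
      exact hγL s (hIccJ hs)
    -- Just before `s₁` the curve repeats its values just before `s₂`.
    have hper : ∀ᶠ s in 𝓝 s₁, γ s = γ (s + (s₂ - s₁)) := by
      have h3 : IsSolOn (fun z => Complex.I * V z) U (fun s => γ (s - (s₁ - s₂)))
          ((fun s => s - (s₁ - s₂)) ⁻¹' J) := hγ.comp_sub _
      have hcn : ContinuousAt (fun s : ℝ => s - (s₁ - s₂)) s₁ := by fun_prop
      have hpre : (fun s : ℝ => s - (s₁ - s₂)) ⁻¹' J ∈ 𝓝 s₁ :=
        hcn (hJo.mem_nhds (by simpa using h2))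
      have := IsSolOn.eventuallyEq hW (inter_mem (hJo.mem_nhds h1) hpre)
        (hγ.mono inter_subset_left) (h3.mono inter_subset_right) (by simpa using heq)
      filter_upwards [this] with s hs
      rw [hs]
      congr 1
      ring
    have hstart : ∀ᶠ w in 𝓝 (γ s₁), w ∈ L → w ∈ γ '' Icc s₁ s₂ := by
      have hJ' : {s | γ s = γ (s + (s₂ - s₁))} ∩ Ioo (s₁ - (s₂ - s₁)) s₂ ∈ 𝓝 s₁ :=
        inter_mem hper (Ioo_mem_nhds (by linarith) hlt)
      filter_upwards [hcover s₁ h1 _ hJ'] with w hw hwL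
      obtain ⟨s, ⟨hs1, hs2⟩, rfl⟩ := hw hwL
      rcases le_or_gt s₁ s with hle | hgt
      · exact ⟨s, ⟨hle, hs2.2.le⟩, rfl⟩
      · exact ⟨s + (s₂ - s₁), ⟨by linarith [hs2.1], by linarith⟩, hs1.symm⟩
    have hsub : L ⊆ γ '' Icc s₁ s₂ := by
      refine hconn.subset_of_eventually
        ⟨γ s₁, hγL s₁ h1, s₁, left_mem_Icc.2 hlt.le, rfl⟩ ?_ ?_
      · rintro _ ⟨-, s, hs, rfl⟩
        rcases hs.1.eq_or_lt with rfl | hs1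
        · exact hstart
        rcases hs.2.eq_or_lt with rfl | hs2
        · rw [← heq]; exact hstart
        · exact hcover s (hIccJ hs) _ (Icc_mem_nhds hs1 hs2)
      · rintro q ⟨-, hqA⟩
        filter_upwards [hAc.isClosed.isOpen_compl.mem_nhds hqA] with w hw _ using hw
    exact hcomp (hsub.antisymm hAL ▸ hAc)
  have hinj : InjOn γ J := fun s₁ h1 s₂ h2 heq => by
    rcases lt_trichotomy s₁ s₂ with h | h | h
    · exact absurd heq (hnolt s₁ h1 s₂ h2 h)
    · exact h
    · exact absurd heq.symm (hnolt s₂ h2 s₁ h1 h)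
  let g : J → L := fun s => ⟨γ s, hγL s s.2⟩
  have hg : IsOpenEmbedding g := by
    refine .of_continuous_injective_isOpenMap
      (hγ.continuousOn.domRestrict.subtype_mk _)
      (fun s₁ s₂ h => Subtype.ext (hinj s₁.2 s₂.2 (congrArg Subtype.val h)))
      (isOpenMap_iff_nhds_le.2 fun s A hA => ?_)
    have hJ' : Subtype.val '' (g ⁻¹' A) ∈ 𝓝 (s : ℝ) :=
      hJo.isOpenMap_subtype_val.image_mem_nhds hA
    have hev : ∀ᶠ w : L in 𝓝 (g s), (w : ℂ) ∈ L → (w : ℂ) ∈ γ '' (Subtype.val '' (g ⁻¹' A)) :=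
      (continuous_subtype_val.tendsto (g s)).eventually (hcover s s.2 _ hJ')
    filter_upwards [hev] with w hw
    obtain ⟨_, ⟨r, hr, rfl⟩, hrw⟩ := hw w.2
    have : g r = w := Subtype.ext hrw
    exact this ▸ hr
  obtain ⟨h, hemb, hrange⟩ := exists_isEmbedding_range_eq hJo hJ ⟨0, h0⟩
  have hhJ : ∀ x, h x ∈ J := fun x => hrange ▸ mem_range_self x
  refine ⟨fun x => g ⟨h x, hhJ x⟩, ?_, ?_⟩
  · exact IsEmbedding.subtypeVal.comp (hg.isEmbedding.comp (hemb.codRestrict J hhJ))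
  · refine Subset.antisymm ?_ fun z hz => ?_
    · rintro _ ⟨x, rfl⟩
      exact (g _).2
    · obtain ⟨s, hs, rfl⟩ := hsurj hz
      obtain ⟨x, rfl⟩ := hrange.symm ▸ hs
      exact ⟨x, rfl⟩

/-! ### The derivative of an injective holomorphic function -/

/-- If `f'(z) = 0`, then `f = f z + ψ ^ n` near `z` with `n ≥ 2` and `ψ` a local biholomorphism
with `ψ z = 0`. Such an `f` takes the same value where `ψ = x` and where `ψ = ζ x`, for `ζ ≠ 1` an
`n`-th root of unity. -/
theorem AnalyticAt.deriv_ne_zero_of_injOn {f : ℂ → ℂ} {z : ℂ} (hf : AnalyticAt ℂ f z) {U : Set ℂ}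
    (hU : U ∈ 𝓝 z) (hinj : InjOn f U) : deriv f z ≠ 0 := by
  intro hd
  have hnz : ¬ ∀ᶠ w in 𝓝 z, f w - f z = 0 := by
    intro hev
    obtain ⟨w, ⟨hw, hwU⟩, hwz⟩ := (((hev.and hU).filter_mono nhdsWithin_le_nhds).and
      (self_mem_nhdsWithin (s := {z}ᶜ))).exists
    exact hwz (hinj hwU (mem_of_mem_nhds hU) (sub_eq_zero.1 hw))
  obtain ⟨n, h, hh, hhz, hn⟩ :=
    (hf.sub analyticAt_const).exists_eventuallyEq_pow_smul_nonzero_iff.2 hnz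
  simp only [Pi.sub_apply, smul_eq_mul] at hn
  have hn0 : n ≠ 0 := by
    rintro rfl
    have := hn.self_of_nhds
    simp at this
    exact hhz this.symm
  have hn1 : n ≠ 1 := by
    rintro rfl
    have h1 : HasDerivAt (fun w => (w - z) ^ 1 * h w) (h z) z := by
      simpa using ((hasDerivAt_id z).sub_const z).fun_mul hh.differentiableAt.hasDerivAt
    have h2 := (h1.congr_of_eventuallyEq hn).deriv
    rw [deriv_sub_const, hd] at h2
    exact hhz h2.symm
  have hnC : (n : ℂ) ≠ 0 := Nat.cast_ne_zero.2 hn0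
  obtain ⟨a, ha⟩ := IsAlgClosed.exists_pow_nat_eq (h z) (Nat.pos_of_ne_zero hn0)
  have ha0 : a ≠ 0 := by
    rintro rfl
    exact hhz (by rw [← ha, zero_pow hn0])
  -- A holomorphic branch of the `n`-th root of `h` near `z`.
  set k : ℂ → ℂ := fun w => a * Complex.exp (Complex.log (h w / h z) / n) with hk
  have hka : AnalyticAt ℂ k z := by
    refine analyticAt_const.mul (AnalyticAt.cexp ?_)
    refine ((hh.div analyticAt_const hhz).clog ?_).div analyticAt_const hnC
    simp [hhz]
  have hkz : k z = a := by simp [hk, hhz]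
  have hkn : ∀ᶠ w in 𝓝 z, k w ^ n = h w := by
    filter_upwards [hh.continuousAt.eventually_ne hhz] with w hw
    rw [hk, mul_pow, ← Complex.exp_nat_mul, mul_div_cancel₀ _ hnC,
      Complex.exp_log (div_ne_zero hw hhz), ha, mul_div_cancel₀ _ hhz]
  set ψ : ℂ → ℂ := fun w => (w - z) * k w with hψ
  have hψd : HasStrictDerivAt ψ a z := by
    have h1 : HasStrictDerivAt (fun w => w - z) 1 z := (hasStrictDerivAt_id z).sub_const z
    simpa [hkz] using h1.fun_mul hka.hasStrictDerivAt
  have hψz : ψ z = 0 := by simp [hψ]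
  have hmap := hψd.map_nhds_eq ha0
  rw [hψz] at hmap
  set W : Set ℂ := U ∩ {w | f w - f z = ψ w ^ n} with hW
  have hWz : W ∈ 𝓝 z := by
    refine inter_mem hU ?_
    filter_upwards [hn, hkn] with w h1 h2
    rw [h1, hψ, mul_pow, h2]
  have himg : ψ '' W ∈ 𝓝 (0 : ℂ) := hmap ▸ image_mem_map hWz
  set ζ : ℂ := Complex.exp (2 * Real.pi * Complex.I / n) with hζ
  have hprim : IsPrimitiveRoot ζ n := Complex.isPrimitiveRoot_exp n hn0
  have himg' : ∀ᶠ x in 𝓝 (0 : ℂ), ζ * x ∈ ψ '' W := by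
    have hc : Tendsto (fun x : ℂ => ζ * x) (𝓝 0) (𝓝 0) := by
      simpa using (continuous_const_mul ζ).tendsto 0
    exact hc.eventually himg
  obtain ⟨x, ⟨⟨w₁, hw₁, h1⟩, w₂, hw₂, h2⟩, hx⟩ :=
    ((((eventually_mem_set.2 himg).and himg').filter_mono nhdsWithin_le_nhds).and
      (self_mem_nhdsWithin (s := {(0 : ℂ)}ᶜ))).exists
  have hfe : f w₁ = f w₂ := by
    have e1 : f w₁ - f z = ψ w₁ ^ n := hw₁.2
    have e2 : f w₂ - f z = ψ w₂ ^ n := hw₂.2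
    rw [h1] at e1
    rw [h2, mul_pow, hprim.pow_eq_one, one_mul] at e2
    exact sub_left_inj.1 (e1.trans e2.symm)
  have hww := hinj hw₁.1 hw₂.1 hfe
  rw [← hww, h1] at h2
  have hζ1 : ζ ≠ 1 := hprim.ne_one (by omega)
  exact hζ1 (mul_right_cancel₀ hx (by rw [one_mul]; exact h2.symm))

/-! ### The Schwarz–Pick lemma -/

theorem mem_unitDisk {z : ℂ} : z ∈ unitDisk ↔ ‖z‖ < 1 := by simp [unitDisk]

theorem isOpen_unitDisk : IsOpen unitDisk := isOpen_ball

theorem one_sub_norm_sq_pos {z : ℂ} (hz : z ∈ unitDisk) : 0 < 1 - ‖z‖ ^ 2 := by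
  have := mem_unitDisk.1 hz
  nlinarith [norm_nonneg z]

/-- The automorphism `w ↦ (w + a) / (1 + ā w)` of the disk, which takes `0` to `a`. -/
noncomputable def diskAut (a w : ℂ) : ℂ := (w + a) / (1 + (starRingEnd ℂ) a * w)

theorem one_add_conj_mul_ne_zero {a w : ℂ} (ha : a ∈ unitDisk) (hw : w ∈ unitDisk) :
    1 + (starRingEnd ℂ) a * w ≠ 0 := by
  rw [mem_unitDisk] at ha hw
  intro h
  have h1 : ‖(starRingEnd ℂ) a * w‖ = 1 := by
    rw [eq_neg_of_add_eq_zero_right h, norm_neg, norm_one]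
  rw [norm_mul, Complex.norm_conj] at h1
  nlinarith [norm_nonneg a, norm_nonneg w]

theorem diskAut_mem {a w : ℂ} (ha : a ∈ unitDisk) (hw : w ∈ unitDisk) :
    diskAut a w ∈ unitDisk := by
  have hne := one_add_conj_mul_ne_zero ha hw
  have h1 := one_sub_norm_sq_pos ha
  have h2 := one_sub_norm_sq_pos hw
  rw [mem_unitDisk, diskAut, norm_div, div_lt_one (norm_pos_iff.2 hne)]
  refine lt_of_pow_lt_pow_left₀ 2 (norm_nonneg _) ?_
  have h3 := mul_pos h1 h2
  rw [Complex.sq_norm, Complex.sq_norm, Complex.normSq_apply, Complex.normSq_apply] at h3 ⊢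
  simp only [Complex.add_re, Complex.add_im, Complex.mul_re, Complex.mul_im, Complex.conj_re,
    Complex.conj_im, Complex.one_re, Complex.one_im]
  nlinarith

theorem hasDerivAt_diskAut {a w : ℂ} (ha : a ∈ unitDisk) (hw : w ∈ unitDisk) :
    HasDerivAt (diskAut a)
      (((1 - ‖a‖ ^ 2 : ℝ) : ℂ) / (1 + (starRingEnd ℂ) a * w) ^ 2) w := by
  have hne := one_add_conj_mul_ne_zero ha hw
  have h1 : HasDerivAt (fun w : ℂ => w + a) 1 w := (hasDerivAt_id w).add_const a
  have h2 : HasDerivAt (fun w : ℂ => 1 + (starRingEnd ℂ) a * w) ((starRingEnd ℂ) a) w := by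
    simpa using ((hasDerivAt_id w).const_mul ((starRingEnd ℂ) a)).const_add 1
  refine (h1.fun_div h2 hne).congr_deriv ?_
  congr 1
  have : (starRingEnd ℂ) a * a = ((‖a‖ ^ 2 : ℝ) : ℂ) := by
    rw [Complex.conj_mul']; push_cast; rfl
  push_cast at this ⊢
  linear_combination -this

/-- The **Schwarz–Pick lemma** in infinitesimal form. -/
theorem norm_hypD_le_one {φ : ℂ → ℂ} (hφ : DifferentiableOn ℂ φ unitDisk)
    (hmaps : MapsTo φ unitDisk unitDisk) {z : ℂ} (hz : z ∈ unitDisk) : ‖hypD φ z‖ ≤ 1 := by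
  have h0 : (0 : ℂ) ∈ unitDisk := mem_unitDisk.2 (by simp)
  have hb : -φ z ∈ unitDisk := mem_unitDisk.2 (by simpa using mem_unitDisk.1 (hmaps hz))
  have hz0 : diskAut z 0 = z := by simp [diskAut]
  set g : ℂ → ℂ := fun w => diskAut (-φ z) (φ (diskAut z w)) with hg
  have hgm : MapsTo g (ball 0 1) (ball 0 1) := fun w hw =>
    diskAut_mem hb (hmaps (diskAut_mem hz hw))
  have hφd : ∀ w ∈ unitDisk, HasDerivAt φ (deriv φ w) w := fun w hw =>
    (hφ.differentiableAt (isOpen_unitDisk.mem_nhds hw)).hasDerivAt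
  have hgd := fun w (hw : w ∈ unitDisk) =>
    HasDerivAt.comp (h := fun w => φ (diskAut z w)) w
      (hasDerivAt_diskAut hb (hmaps (diskAut_mem hz hw)))
      (HasDerivAt.comp w (hφd _ (diskAut_mem hz hw)) (hasDerivAt_diskAut hz hw))
  have hg0 : g 0 = 0 := by simp [hg, diskAut]
  have hle := Complex.norm_deriv_le_one_of_mapsTo_ball (f := g) (c := 0) (R := 1)
    (fun w hw => (hgd w hw).differentiableAt.differentiableWithinAt)
    (by rw [hg0]; exact hgm.mono_right ball_subset_closedBall) one_pos
  have hder : deriv g 0 = _ := (hgd 0 h0).deriv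
  rw [hder, hz0] at hle
  have hpos := one_sub_norm_sq_pos (hmaps hz)
  have heq : (1 : ℂ) + (starRingEnd ℂ) (-φ z) * φ z = ((1 - ‖φ z‖ ^ 2 : ℝ) : ℂ) := by
    rw [map_neg, neg_mul, Complex.conj_mul']; push_cast; ring
  have hne : ((1 - ‖φ z‖ ^ 2 : ℝ) : ℂ) ≠ 0 := by exact_mod_cast hpos.ne'
  rw [heq, norm_neg, mul_zero, add_zero, one_pow, div_one] at hle
  refine (congrArg norm ?_).trans_le hle
  rw [hypD]
  field_simp

/-! ### The function `|D_φ|` and its gradient field -/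

section Level

variable {φ : ℂ → ℂ} {z : ℂ}

theorem deriv_ne_zero_of_locallyUnivalent (hφ : DifferentiableOn ℂ φ unitDisk)
    (huniv : LocallyUnivalent φ) (hz : z ∈ unitDisk) : deriv φ z ≠ 0 := by
  obtain ⟨U, hU, hinj⟩ := huniv z hz
  exact (hφ.analyticAt (isOpen_unitDisk.mem_nhds hz)).deriv_ne_zero_of_injOn hU hinj

/-- The autonomous field that agrees with the trajectory field at time `t` on the level set of `t`.
Where `A_φ ≠ 0` it is the normalized gradient `∇|D_φ| / |∇|D_φ||²`. -/
noncomputable def levelField (φ : ℂ → ℂ) (z : ℂ) : ℂ := trajField φ ‖hypD φ z‖ z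

theorem re_wirtingerDz_mul (u : ℂ → ℝ) (z v : ℂ) :
    2 * (wirtingerDz u z * v).re = fderiv ℝ u z v := by
  have hv : v = v.re • (1 : ℂ) + v.im • Complex.I := by
    simp [Complex.re_add_im]
  conv_rhs => rw [hv, map_add, map_smul, map_smul]
  simp [wirtingerDz]
  ring

/-- A holomorphic self-map of the disk with `φ'` and `A_φ` free of zeros: the regular set is the
whole disk. -/
structure IsRegularSelfMap (φ : ℂ → ℂ) : Prop where
  differentiableOn : DifferentiableOn ℂ φ unitDisk
  mapsTo : MapsTo φ unitDisk unitDisk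
  deriv_ne_zero : ∀ z ∈ unitDisk, deriv φ z ≠ 0
  hypA_ne_zero : ∀ z ∈ unitDisk, hypA φ z ≠ 0

namespace IsRegularSelfMap

theorem hypD_ne_zero (h : IsRegularSelfMap φ) (hz : z ∈ unitDisk) : hypD φ z ≠ 0 := by
  have h1 := (one_sub_norm_sq_pos hz).ne'
  have h2 := (one_sub_norm_sq_pos (h.mapsTo hz)).ne'
  exact div_ne_zero (mul_ne_zero (by exact_mod_cast h1) (h.deriv_ne_zero z hz))
    (by exact_mod_cast h2)

theorem contDiffAt_hypD (h : IsRegularSelfMap φ) (hz : z ∈ unitDisk) :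
    ContDiffAt ℝ 2 (hypD φ) z := by
  have han : AnalyticAt ℂ φ z := h.differentiableOn.analyticAt (isOpen_unitDisk.mem_nhds hz)
  have h1 : ContDiffAt ℝ 2 φ z := han.contDiffAt.restrict_scalars ℝ
  have h2 : ContDiffAt ℝ 2 (deriv φ) z := han.deriv.contDiffAt.restrict_scalars ℝ
  have h3 : ContDiffAt ℝ 2 (fun w : ℂ => ((1 - ‖w‖ ^ 2 : ℝ) : ℂ)) z :=
    Complex.ofRealCLM.contDiff.contDiffAt.comp z
      (contDiffAt_const.sub (contDiff_norm_sq ℝ).contDiffAt)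
  have h4 : ContDiffAt ℝ 2 (fun w : ℂ => ((1 - ‖φ w‖ ^ 2 : ℝ) : ℂ)) z :=
    Complex.ofRealCLM.contDiff.contDiffAt.comp z (contDiffAt_const.sub (h1.norm_sq ℝ))
  have h5 : ((1 - ‖φ z‖ ^ 2 : ℝ) : ℂ) ≠ 0 := by
    exact_mod_cast (one_sub_norm_sq_pos (h.mapsTo hz)).ne'
  exact ((h3.mul h2).mul (h4.inv h5)).congr_of_eventuallyEq
    (Eventually.of_forall fun w => div_eq_mul_inv _ _)

theorem contDiffAt_norm_hypD (h : IsRegularSelfMap φ) (hz : z ∈ unitDisk) :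
    ContDiffAt ℝ 2 (fun w => ‖hypD φ w‖) z :=
  (h.contDiffAt_hypD hz).norm ℝ (h.hypD_ne_zero hz)

theorem contDiffAt_log_norm_hypD (h : IsRegularSelfMap φ) (hz : z ∈ unitDisk) :
    ContDiffAt ℝ 2 (fun w => Real.log ‖hypD φ w‖) z :=
  (h.contDiffAt_norm_hypD hz).log (norm_ne_zero_iff.2 (h.hypD_ne_zero hz))

theorem contDiffAt_hypA (h : IsRegularSelfMap φ) (hz : z ∈ unitDisk) :
    ContDiffAt ℝ 1 (hypA φ) z := by
  have h1 : ContDiffAt ℝ 1 (fderiv ℝ (fun w => Real.log ‖hypD φ w‖)) z :=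
    (h.contDiffAt_log_norm_hypD hz).fderiv_right (m := 1) (by norm_num)
  have h2 : ∀ v : ℂ, ContDiffAt ℝ 1
      (fun w => ((fderiv ℝ (fun w => Real.log ‖hypD φ w‖) w v : ℝ) : ℂ)) z := fun v =>
    Complex.ofRealCLM.contDiff.contDiffAt.comp z (h1.clm_apply contDiffAt_const)
  have h3 : ContDiffAt ℝ 1 (fun w : ℂ => ((1 - ‖w‖ ^ 2 : ℝ) : ℂ)) z :=
    Complex.ofRealCLM.contDiff.contDiffAt.comp z
      (contDiffAt_const.sub (contDiff_norm_sq ℝ).contDiffAt)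
  exact h3.mul (contDiffAt_const.mul ((h2 1).sub (contDiffAt_const.mul (h2 Complex.I))))

theorem contDiffAt_levelField (h : IsRegularSelfMap φ) (hz : z ∈ unitDisk) :
    ContDiffAt ℝ 1 (levelField φ) z := by
  have h1 : ContDiffAt ℝ 1 (fun w => ((‖hypD φ w‖ : ℝ) : ℂ)) z :=
    Complex.ofRealCLM.contDiff.contDiffAt.comp z
      ((h.contDiffAt_norm_hypD hz).of_le (by norm_num))
  have h3 : ContDiffAt ℝ 1 (fun w : ℂ => ((1 - ‖w‖ ^ 2 : ℝ) : ℂ)) z :=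
    Complex.ofRealCLM.contDiff.contDiffAt.comp z
      (contDiffAt_const.sub (contDiff_norm_sq ℝ).contDiffAt)
  have h4 : ((‖hypD φ z‖ : ℝ) : ℂ) ≠ 0 := by
    exact_mod_cast norm_ne_zero_iff.2 (h.hypD_ne_zero hz)
  exact (h3.mul (((contDiffAt_const.mul h1).mul (h.contDiffAt_hypA hz)).inv
    (mul_ne_zero (mul_ne_zero two_ne_zero h4) (h.hypA_ne_zero z hz)))).congr_of_eventuallyEq
    (Eventually.of_forall fun w => div_eq_mul_inv _ _)

/-- In terms of the field, the derivative of `|D_φ|` at `z` in the direction `v` is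
`Re (v / levelField φ z)`. -/
theorem fderiv_norm_hypD_mul_levelField (h : IsRegularSelfMap φ) (hz : z ∈ unitDisk) (k : ℂ) :
    fderiv ℝ (fun w => ‖hypD φ w‖) z (k * levelField φ z) = k.re := by
  have hn : ‖hypD φ z‖ ≠ 0 := norm_ne_zero_iff.2 (h.hypD_ne_zero hz)
  have hlog : fderiv ℝ (fun w => Real.log ‖hypD φ w‖) z =
      ‖hypD φ z‖⁻¹ • fderiv ℝ (fun w => ‖hypD φ w‖) z :=
    (((h.contDiffAt_norm_hypD hz).differentiableAt two_ne_zero).hasFDerivAt.log hn).fderiv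
  have h1 := re_wirtingerDz_mul (fun w => Real.log ‖hypD φ w‖) z (k * levelField φ z)
  rw [hlog, smul_apply, smul_eq_mul] at h1
  have hD : ((1 - ‖z‖ ^ 2 : ℝ) : ℂ) ≠ 0 := by exact_mod_cast (one_sub_norm_sq_pos hz).ne'
  have hW : wirtingerDz (fun w => Real.log ‖hypD φ w‖) z ≠ 0 :=
    right_ne_zero_of_mul (h.hypA_ne_zero z hz)
  have hnC : ((‖hypD φ z‖ : ℝ) : ℂ) ≠ 0 := by exact_mod_cast hn
  have h2 : wirtingerDz (fun w => Real.log ‖hypD φ w‖) z * (k * levelField φ z) =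
      ((2 * ‖hypD φ z‖)⁻¹ : ℝ) * k := by
    rw [levelField, trajField, hypA]
    push_cast at hD ⊢
    field_simp
  rw [h2, Complex.re_ofReal_mul] at h1
  field_simp at h1
  linarith

theorem differentiableAt_norm_hypD (h : IsRegularSelfMap φ) (hz : z ∈ unitDisk) :
    DifferentiableAt ℝ (fun w => ‖hypD φ w‖) z :=
  (h.contDiffAt_norm_hypD hz).differentiableAt two_ne_zero

theorem fderiv_levelField (h : IsRegularSelfMap φ) (hz : z ∈ unitDisk) :
    fderiv ℝ (fun w => ‖hypD φ w‖) z (levelField φ z) = 1 := by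
  simpa using h.fderiv_norm_hypD_mul_levelField hz 1

theorem norm_hypD_pos (h : IsRegularSelfMap φ) (hz : z ∈ unitDisk) : 0 < ‖hypD φ z‖ :=
  norm_pos_iff.2 (h.hypD_ne_zero hz)

/-- A point where `|D_φ|` reached the bound `1` would be a maximum, hence a critical point. -/
theorem norm_hypD_lt_one (h : IsRegularSelfMap φ) (hz : z ∈ unitDisk) : ‖hypD φ z‖ < 1 := by
  refine lt_of_le_of_ne (norm_hypD_le_one h.differentiableOn h.mapsTo hz) fun h1 => ?_
  have hmax : IsLocalMax (fun w => ‖hypD φ w‖) z := by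
    filter_upwards [isOpen_unitDisk.mem_nhds hz] with w hw
    exact h1 ▸ norm_hypD_le_one h.differentiableOn h.mapsTo hw
  have := h.fderiv_levelField hz
  rw [hmax.fderiv_eq_zero] at this
  simp at this

/-! ### Trajectories -/

/-- The parameter of a trajectory is the level: `|D_φ(z(t))| = t`. -/
theorem norm_hypD_eq_of_isTrajSolution (h : IsRegularSelfMap φ) {z₀ : ℂ} {a b : ℝ} {γ : ℝ → ℂ}
    (hγ : IsTrajSolution φ z₀ a b γ) {t : ℝ} (ht : t ∈ Ioo a b) : ‖hypD φ (γ t)‖ = t := by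
  have hpos : ∀ s ∈ Ioo a b, 0 < s := fun s hs => (hγ.interval_subset hs).1
  have hder : ∀ s ∈ Ioo a b, HasDerivAt (fun s => ‖hypD φ (γ s)‖ / s) 0 s := by
    intro s hs
    have hU := (hγ.mem_regularSet s hs).1
    have hs0 := (hpos s hs).ne'
    have hn := (h.norm_hypD_pos hU).ne'
    have hfield : trajField φ s (γ s) = ((‖hypD φ (γ s)‖ / s : ℝ) : ℂ) * levelField φ (γ s) := by
      have hA := h.hypA_ne_zero _ hU
      have hsC : (s : ℂ) ≠ 0 := by exact_mod_cast hs0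
      have hnC : ((‖hypD φ (γ s)‖ : ℝ) : ℂ) ≠ 0 := by exact_mod_cast hn
      rw [levelField, trajField, trajField]
      push_cast
      field_simp
    have h1 := (h.differentiableAt_norm_hypD hU).hasFDerivAt.comp_hasDerivAt s (hγ.hasDerivAt s hs)
    rw [hfield, h.fderiv_norm_hypD_mul_levelField hU, Complex.ofReal_re] at h1
    refine (h1.fun_div (hasDerivAt_id s) hs0).congr_deriv ?_
    simp only [Function.comp_apply, id]
    field_simp
    ring
  have hc := isOpen_Ioo.is_const_of_deriv_eq_zero isPreconnected_Ioo
    (fun s hs => (hder s hs).differentiableAt.differentiableWithinAt)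
    (fun s hs => (hder s hs).deriv) ht hγ.level_mem
  have ht0 := (hpos _ hγ.level_mem).ne'
  rw [hγ.initial, div_self ht0, div_eq_one_iff_eq (hpos t ht).ne'] at hc
  exact hc

theorem isSolOn_of_isTrajSolution (h : IsRegularSelfMap φ) {z₀ : ℂ} {a b : ℝ} {γ : ℝ → ℂ}
    (hγ : IsTrajSolution φ z₀ a b γ) : IsSolOn (levelField φ) unitDisk γ (Ioo a b) := fun t ht => by
  refine ⟨(hγ.mem_regularSet t ht).1, ?_⟩
  rw [levelField, h.norm_hypD_eq_of_isTrajSolution hγ ht]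
  exact hγ.hasDerivAt t ht

theorem norm_hypD_eq_of_isSolOn (h : IsRegularSelfMap φ) {z₀ : ℂ} {J : Set ℝ}
    {γ : ℝ → ℂ} (hγ : IsSolOn (levelField φ) unitDisk γ J) (hJo : IsOpen J) (hJ : IsPreconnected J)
    (hz₀ : ‖hypD φ z₀‖ ∈ J) (h0 : γ ‖hypD φ z₀‖ = z₀) {t : ℝ} (ht : t ∈ J) :
    ‖hypD φ (γ t)‖ = t := by
  have := hγ.level_sub_level (f := fun w => ‖hypD φ w‖) hJo hJ
    (fun z hz => h.differentiableAt_norm_hypD hz) (fun z hz => h.fderiv_levelField hz) hz₀ ht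
  simp only [h0] at this
  linarith

theorem exists_isTrajectory (h : IsRegularSelfMap φ) {z₀ : ℂ} (hz₀ : z₀ ∈ unitDisk) :
    ∃ (a b : ℝ) (γ : ℝ → ℂ), IsTrajectory φ z₀ a b γ := by
  obtain ⟨γ, J, hJo, hJ, hzJ, h0, hγ, hmax⟩ := exists_maximal_isSolOn isOpen_unitDisk
    (fun z hz => h.contDiffAt_levelField hz) hz₀ ‖hypD φ z₀‖
  have hlev : ∀ t ∈ J, ‖hypD φ (γ t)‖ = t := fun t ht =>
    h.norm_hypD_eq_of_isSolOn hγ hJo hJ hzJ h0 ht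
  have hJ01 : J ⊆ Ioo 0 1 := fun t ht => by
    have h1 := h.norm_hypD_pos (hγ t ht).1
    have h2 := h.norm_hypD_lt_one (hγ t ht).1
    rw [hlev t ht] at h1 h2
    exact ⟨h1, h2⟩
  obtain ⟨a, b, rfl⟩ : ∃ a b, J = Ioo a b := ⟨_, _, hJo.eq_Ioo_csInf_csSup ⟨⟨_, hzJ⟩, hJ⟩
    (bddBelow_Ioo.mono hJ01) (bddAbove_Ioo.mono hJ01)⟩
  refine ⟨a, b, γ, ⟨hJ01, hzJ, h0, fun t ht => ?_, fun t ht => ?_⟩, ?_⟩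
  · have hU := (hγ t ht).1
    exact ⟨hU, h.deriv_ne_zero _ hU, h.hypA_ne_zero _ hU⟩
  · have := (hγ t ht).2
    rwa [levelField, hlev t ht] at this
  · intro a' b' w hw haa hbb _
    have hsub := (hmax w (Ioo a' b') isOpen_Ioo isPreconnected_Ioo (h.isSolOn_of_isTrajSolution hw)
      _ ⟨hzJ, hw.level_mem⟩ (h0.trans hw.initial.symm)).1
    obtain ⟨h1, h2⟩ := (Ioo_subset_Ioo_iff (hw.level_mem.1.trans hw.level_mem.2)).1 hsub
    exact ⟨haa.antisymm h1, h2.antisymm hbb⟩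

/-- If all trajectories run through all levels, they form a level flow. -/
theorem exists_isLevelFlow (h : IsRegularSelfMap φ)
    (hω : ∀ z₀ ∈ unitDisk, ∀ (a b : ℝ) (z : ℝ → ℂ), IsTrajectory φ z₀ a b z →
      a = levelInf φ ∧ b = levelSup φ) :
    ∃ Φ : ℂ → ℝ → ℂ, IsLevelFlow (levelField φ) (fun w => ‖hypD φ w‖) unitDisk
      (levelInf φ) (levelSup φ) Φ := by
  have hex : ∀ z₀ ∈ unitDisk, ∃ γ : ℝ → ℂ, IsTrajSolution φ z₀ (levelInf φ) (levelSup φ) γ := by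
    intro z₀ hz₀
    obtain ⟨a, b, γ, hγ⟩ := h.exists_isTrajectory hz₀
    obtain ⟨rfl, rfl⟩ := hω z₀ hz₀ a b γ hγ
    exact ⟨γ, hγ.toIsTrajSolution⟩
  choose! Φ hΦ using hex
  exact ⟨Φ, isOpen_unitDisk, fun z hz => h.contDiffAt_levelField hz,
    fun z hz => h.differentiableAt_norm_hypD hz, fun z hz => h.fderiv_levelField hz,
    fun z hz => h.isSolOn_of_isTrajSolution (hΦ z hz), fun z hz => (hΦ z hz).level_mem,
    fun z hz => (hΦ z hz).initial⟩

end IsRegularSelfMap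

end Level

/-! ### Decreasing families of compact connected sets -/

/-- The intersection of a directed family of compact connected sets is connected. -/
theorem isConnected_iInter_of_directed {X ι : Type*} [MetricSpace X] [Nonempty ι] {K : ι → Set X}
    (hdir : Directed (· ⊇ ·) K) (hcomp : ∀ i, IsCompact (K i)) (hconn : ∀ i, IsConnected (K i)) :
    IsConnected (⋂ i, K i) := by
  refine ⟨IsCompact.nonempty_iInter_of_directed_nonempty_isCompact_isClosed K hdir
    (fun i => (hconn i).nonempty) hcomp fun i => (hcomp i).isClosed, ?_⟩
  rw [isPreconnected_iff_subset_of_fully_disjoint_closed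
    (isClosed_iInter fun i => (hcomp i).isClosed)]
  intro u v hu hv huv hdisj
  obtain ⟨u', v', hu'o, hv'o, huu', hvv', hdisj'⟩ := normal_separation hu hv hdisj
  obtain ⟨i, hi⟩ := exists_subset_nhds_of_isCompact hdir hcomp (U := u' ∪ v') fun x hx =>
    (hu'o.union hv'o).mem_nhds ((union_subset_union huu' hvv') (huv hx))
  rcases (hconn i).isPreconnected.subset_or_subset hu'o hv'o hdisj' hi with hsub | hsub
  · refine Or.inl fun x hx => (huv hx).resolve_right fun hxv => ?_
    exact hdisj'.le_bot ⟨hsub (mem_iInter.1 hx i), hvv' hxv⟩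
  · refine Or.inr fun x hx => (huv hx).resolve_left fun hxu => ?_
    exact hdisj'.le_bot ⟨huu' hxu, hsub (mem_iInter.1 hx i)⟩

/-! ### The end set -/

section EndSet

variable {φ : ℂ → ℂ}

theorem endSet_eq_iInter (φ : ℂ → ℂ) : endSet φ =
    ⋂ t : Ioo (levelInf φ) (levelSup φ), closure (superLevelSet φ t) := by
  rw [endSet, biInter_eq_iInter]

theorem directed_closure_superLevelSet (φ : ℂ → ℂ) : Directed (· ⊇ ·)
    fun t : Ioo (levelInf φ) (levelSup φ) => closure (superLevelSet φ t) := by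
  refine directed_of_isDirected_le fun s t hst => closure_mono fun z hz => ?_
  exact ⟨hz.1, le_trans hst hz.2⟩

theorem closure_superLevelSet_subset (φ : ℂ → ℂ) (t : ℝ) :
    closure (superLevelSet φ t) ⊆ closedBall 0 1 :=
  closure_minimal (fun _ hz => ball_subset_closedBall hz.1) isClosed_closedBall

theorem isCompact_closure_superLevelSet (φ : ℂ → ℂ) (t : ℝ) :
    IsCompact (closure (superLevelSet φ t)) :=
  (isCompact_closedBall _ _).of_isClosed_subset isClosed_closure (closure_superLevelSet_subset φ t)

variable {Φ : ℂ → ℝ → ℂ} {V : ℂ → ℂ}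

theorem nonempty_Ioo_of_isLevelFlow
    (hΦ : IsLevelFlow V (fun w => ‖hypD φ w‖) unitDisk (levelInf φ) (levelSup φ) Φ) :
    (Ioo (levelInf φ) (levelSup φ)).Nonempty :=
  ⟨_, hΦ.mem_Ioo 0 (mem_unitDisk.2 (by simp))⟩

theorem isConnected_endSet
    (hΦ : IsLevelFlow V (fun w => ‖hypD φ w‖) unitDisk (levelInf φ) (levelSup φ) Φ) :
    IsConnected (endSet φ) := by
  have := (nonempty_Ioo_of_isLevelFlow hΦ).to_subtype
  have h0 : (0 : ℂ) ∈ unitDisk := mem_unitDisk.2 (by simp)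
  rw [endSet_eq_iInter]
  refine isConnected_iInter_of_directed (directed_closure_superLevelSet φ)
    (fun t => isCompact_closure_superLevelSet φ t) fun t => IsConnected.closure ⟨?_, ?_⟩
  · exact ⟨Φ 0 t, (hΦ.isSolOn 0 h0 t t.2).1, (hΦ.level_apply h0 t.2).ge⟩
  · exact hΦ.isPreconnected_superlevel (convex_ball (0 : ℂ) 1).isPreconnected t.2

theorem isCompact_endSet
    (hΦ : IsLevelFlow V (fun w => ‖hypD φ w‖) unitDisk (levelInf φ) (levelSup φ) Φ) :
    IsCompact (endSet φ) := by
  obtain ⟨t, ht⟩ := nonempty_Ioo_of_isLevelFlow hΦ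
  exact (isCompact_closure_superLevelSet φ t).of_isClosed_subset
    (isClosed_biInter fun _ _ => isClosed_closure) (biInter_subset_of_mem ht)

/-- No point of the disk is in the end set: its level would be at least `sup |D_φ|`, which is not
attained. -/
theorem endSet_subset_sphere
    (hΦ : IsLevelFlow V (fun w => ‖hypD φ w‖) unitDisk (levelInf φ) (levelSup φ) Φ) :
    endSet φ ⊆ sphere 0 1 := by
  intro z hz
  obtain ⟨t, ht⟩ := nonempty_Ioo_of_isLevelFlow hΦ
  have hle : ‖z‖ ≤ 1 := by
    simpa using closure_superLevelSet_subset φ t (mem_iInter₂.1 hz t ht)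
  rw [mem_sphere_zero_iff_norm]
  refine hle.antisymm (not_lt.1 fun hlt => ?_)
  have hzU : z ∈ unitDisk := mem_unitDisk.2 hlt
  have hI := hΦ.mem_Ioo z hzU
  obtain ⟨s, hzs, hsd⟩ := exists_between hI.2
  have hfr := mem_closure_iff_frequently.1 (mem_iInter₂.1 hz s ⟨hI.1.trans hzs, hsd⟩)
  have hev : ∀ᶠ w in 𝓝 z, ‖hypD φ w‖ < s :=
    (hΦ.differentiableAt z hzU).continuousAt.eventually_lt_const hzs
  obtain ⟨w, hw, hw'⟩ := (hfr.and_eventually hev).exists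
  exact hw'.not_ge hw.2

/-- A curve in the disk whose parameter is its level approaches the end set. -/
theorem forwardTraj_ends_on_endSet
    (hΦ : IsLevelFlow V (fun w => ‖hypD φ w‖) unitDisk (levelInf φ) (levelSup φ) Φ)
    {z₀ : ℂ} (hz₀ : z₀ ∈ unitDisk) {γ : ℝ → ℂ}
    (hc : ContinuousOn γ (Ioo (levelInf φ) (levelSup φ)))
    (hγ : ∀ t ∈ Ioo (levelInf φ) (levelSup φ), γ t ∈ unitDisk ∧ ‖hypD φ (γ t)‖ = t) :
    (closure (forwardTraj φ z₀ (levelSup φ) γ) \ forwardTraj φ z₀ (levelSup φ) γ).Nonempty ∧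
      closure (forwardTraj φ z₀ (levelSup φ) γ) \ forwardTraj φ z₀ (levelSup φ) γ ⊆ endSet φ ∧
      Tendsto (fun t => infDist (γ t) (endSet φ)) (𝓝[<] (levelSup φ)) (𝓝 0) := by
  set c := levelInf φ
  set d := levelSup φ
  set t₀ := ‖hypD φ z₀‖ with ht₀
  have hI : t₀ ∈ Ioo c d := hΦ.mem_Ioo z₀ hz₀
  have hsup : ∀ s ∈ Ioo c d, ∀ t ∈ Ico s d, γ t ∈ superLevelSet φ s := fun s hs t ht => by
    have := hγ t ⟨hs.1.trans_le ht.1, ht.2⟩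
    exact ⟨this.1, ht.1.trans_eq this.2.symm⟩
  have hends : closure (forwardTraj φ z₀ d γ) \ forwardTraj φ z₀ d γ ⊆ endSet φ := by
    rintro w ⟨hw, hwΓ⟩
    refine mem_iInter₂.2 fun s hs => ?_
    -- The part of the curve below level `s` is compact, so `w` is a limit of the other part.
    have hcpt : IsCompact (γ '' Icc t₀ (max t₀ s)) := isCompact_Icc.image_of_continuousOn
      (hc.mono (Icc_subset_Ioo hI.1 (max_lt hI.2 hs.2)))
    have hsub : forwardTraj φ z₀ d γ ⊆ γ '' Icc t₀ (max t₀ s) ∪ superLevelSet φ s := by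
      rintro _ ⟨t, ht, rfl⟩
      rcases le_total t s with hts | hst
      · exact Or.inl ⟨t, ⟨ht.1, hts.trans (le_max_right _ _)⟩, rfl⟩
      · exact Or.inr (hsup s hs t ⟨hst, ht.2⟩)
    have hw' := closure_mono hsub hw
    rw [closure_union, hcpt.isClosed.closure_eq] at hw'
    refine hw'.resolve_left ?_
    rintro ⟨t, ht, rfl⟩
    exact hwΓ ⟨t, ⟨ht.1, ht.2.trans_lt (max_lt hI.2 hs.2)⟩, rfl⟩
  refine ⟨?_, hends, ?_⟩
  · have hne : (𝓝[<] d).NeBot := nhdsLT_neBot_of_exists_lt ⟨t₀, hI.2⟩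
    have hevI : ∀ᶠ t in 𝓝[<] d, t ∈ Ico t₀ d := Ico_mem_nhdsLT hI.2
    obtain ⟨w, -, hw⟩ := (isCompact_closedBall (0 : ℂ) 1).exists_mapClusterPt_of_frequently
      (l := 𝓝[<] d) (f := γ) (hevI.mono fun t ht =>
        ball_subset_closedBall (hγ t ⟨hI.1.trans_le ht.1, ht.2⟩).1).frequently
    have hcl : ∀ S : Set ℂ, (∀ᶠ t in 𝓝[<] d, γ t ∈ S) → w ∈ closure S := fun S hS =>
      mem_closure_iff_clusterPt.2 (ClusterPt.mono hw (le_principal_iff.2 hS))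
    have hwB : w ∈ endSet φ := mem_iInter₂.2 fun s hs => hcl _ <| by
      filter_upwards [Ico_mem_nhdsLT hs.2] with t ht using hsup s hs t ht
    refine ⟨w, hcl _ (hevI.mono fun t ht => mem_image_of_mem γ ht), ?_⟩
    rintro ⟨t, ht, rfl⟩
    have h1 := (hγ t ⟨hI.1.trans_le ht.1, ht.2⟩).1
    have h2 := endSet_subset_sphere hΦ hwB
    rw [mem_unitDisk] at h1
    rw [mem_sphere_zero_iff_norm] at h2
    exact h1.ne h2
  · rw [Metric.tendsto_nhds]
    intro ε hε
    have := (nonempty_Ioo_of_isLevelFlow hΦ).to_subtype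
    obtain ⟨s, hs⟩ := exists_subset_nhds_of_isCompact (directed_closure_superLevelSet φ)
      (fun t => isCompact_closure_superLevelSet φ t) (U := thickening ε (endSet φ)) fun x hx =>
        isOpen_thickening.mem_nhds
          (self_subset_thickening hε _ (by rwa [endSet_eq_iInter]))
    filter_upwards [Ico_mem_nhdsLT s.2.2] with t ht
    have hmem := hs (subset_closure (hsup s s.2 t ht))
    rw [Real.dist_eq, sub_zero, abs_of_nonneg infDist_nonneg]
    exact (mem_thickening_iff_infDist_lt (isConnected_endSet hΦ).nonempty).1 hmem

end EndSet

theorem theorem2 (φ : ℂ → ℂ) (hφ : DifferentiableOn ℂ φ unitDisk)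
    (hmaps : MapsTo φ unitDisk unitDisk) (huniv : LocallyUnivalent φ)
    (hA : ∀ z ∈ unitDisk, hypA φ z ≠ 0)
    (hω : ∀ z₀ ∈ unitDisk, ∀ (a b : ℝ) (z : ℝ → ℂ), IsTrajectory φ z₀ a b z →
      a = levelInf φ ∧ b = levelSup φ) :
    (∀ t ∈ Ioo (levelInf φ) (levelSup φ), IsOpenJordanArc (levelSet φ t)) ∧
    IsCompact (endSet φ) ∧ IsConnected (endSet φ) ∧ endSet φ ⊆ sphere (0 : ℂ) 1 ∧
    ∀ z₀ ∈ unitDisk, ∀ (a b : ℝ) (z : ℝ → ℂ), IsTrajectory φ z₀ a b z →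
      (closure (forwardTraj φ z₀ b z) \ forwardTraj φ z₀ b z).Nonempty ∧
      closure (forwardTraj φ z₀ b z) \ forwardTraj φ z₀ b z ⊆ endSet φ ∧
      Tendsto (fun t => infDist (z t) (endSet φ)) (𝓝[<] b) (𝓝 0) := by
  have h : IsRegularSelfMap φ :=
    ⟨hφ, hmaps, fun z hz => deriv_ne_zero_of_locallyUnivalent hφ huniv hz, hA⟩
  obtain ⟨Φ, hΦ⟩ := h.exists_isLevelFlow hω
  have h0 : (0 : ℂ) ∈ unitDisk := mem_unitDisk.2 (by simp)
  refine ⟨fun t ht => ?_, isCompact_endSet hΦ, isConnected_endSet hΦ, endSet_subset_sphere hΦ,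
    fun z₀ hz₀ a b γ hγ => ?_⟩
  · refine isOpenJordanArc_level isOpen_unitDisk
      (fun z hz => (h.contDiffAt_norm_hypD hz).of_le (by norm_num))
      (fun z hz => h.contDiffAt_levelField hz) (fun z hz => h.fderiv_levelField hz)
      (fun z hz => ?_) ⟨Φ 0 t, (hΦ.isSolOn 0 h0 t ht).1, hΦ.level_apply h0 ht⟩
      (hΦ.isPreconnected_level (convex_ball (0 : ℂ) 1).isPreconnected ht)
      (hΦ.not_isCompact_level ht)
    simpa using h.fderiv_norm_hypD_mul_levelField hz Complex.I
  · obtain ⟨rfl, rfl⟩ := hω z₀ hz₀ a b γ hγ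
    have hsol := h.isSolOn_of_isTrajSolution hγ.toIsTrajSolution
    exact forwardTraj_ends_on_endSet hΦ hz₀ hsol.continuousOn fun t ht =>
      ⟨(hsol t ht).1, h.norm_hypD_eq_of_isTrajSolution hγ.toIsTrajSolution ht⟩
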